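/- **Proposition 6.12 (range of $\mathrm{ad}\,u_\lambda$).** Let $\mathfrak G_0$ be a compact semisimple real Lie algebra (finite-dimensional, with negative definite Killing form), let $U$ be a finite-dimensional real $\mathfrak G_0$-module, and let $\langle\,,\rangle$ be an inner product on $U\oplus\mathfrak G_0$ such that $U\perp\mathfrak G_0$ and every $X\in\mathfrak G_0$ acts skew-symmetrically on $U$ and, by $\mathrm{ad}\,X$, on $\mathfrak G_0$. Let $\mathfrak N_0=U\oplus\mathfrak G_0$ be the real 2-step nilpotent Lie algebra in which $\mathfrak G_0$ is central and, for $u,u'\in U$, $[u,u']\in\mathfrak G_0$ is given by $\langle[u,u'],Z\rangle=\langle Z(u),u'\rangle$ for all $Z\in\mathfrak G_0$. Let $\mathfrak H_0$ be a maximal abelian subalgebra of $\mathfrak G_0$, and put $\mathfrak G=\mathfrak G_0^{\mathbb C}$, $\mathfrak H=\mathfrak H_0^{\mathbb C}$, $V=U^{\mathbb C}$. For $\mu\in\mathrm{Hom}(\mathfrak H,\mathbb C)$ put $V_\mu=\{v\in V: Hv=\mu(H)v\ \ \forall H\in\mathfrak H\}$ and $\mathfrak G_\mu=\{X\in\mathfrak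 G:[H,X]=\mu(H)X\ \ \forall H\in\mathfrak H\}$. Let $\Lambda$ (resp. $\Phi$) be the set of nonzero $\mu$ with $V_\mu\ne\{0\}$ (resp. $\mathfrak G_\mu\neq\{0\}$), and let $\Lambda^+\subseteq\Lambda$ be any subset such that $\Lambda$ is the disjoint union of $\Lambda^+$ and $-\Lambda^+$. For $\mu\ne0$ let $U_\mu=(V_\mu\oplus V_{-\mu})\cap U$ and $\mathfrak G_{0,\mu}=(\mathfrak G_\mu\oplus\mathfrak G_{-\mu})\cap\mathfrak G_0$ (so $\mathfrak G_{0,\mu}=\{0\}$ if $\mu\notin\Phi$). Let $\lambda\in\Lambda^+$ be such that $2\lambda\notin\Phi$ and there are no $\alpha,\beta\in\Phi$ with $2\lambda=\alpha+\beta$. Put $\Phi_\lambda=\{\alpha\in\Phi:V_{\lambda-\alpha}\neq\{0\}\}$. For $\alpha\in\Phi$ choose a nonzero $X_{-\alpha}$ in the line $\mathfrak G_{-\alpha}$ and let $\mathrm{Ker}(X_{-\alpha})=\{v\in V_\lambda: X_{-\alpha}v=0\}$. Let $$\Sigma_\lambda=\bigcup_{\alpha\in\Phi_\lambda}\mathrm{Ker}(X_{-\alpha})\subseteq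 V_\lambda ,$$ with $\mathrm{Ker}(X_{-\lambda})$ added to the union in case $\lambda\in\Phi$, and let $\Sigma'_\lambda=\{v+J(v):v\in\Sigma_\lambda\}\subseteq U_\lambda$, where $J$ is the conjugation of $V$ determined by $U$. Then: 1. $\Sigma'_\lambda$ is a proper Zariski-closed subset of the real vector space $U_\lambda$. 2. There is a unique $\tilde H_\lambda\in\mathfrak H_0$ such that $\langle\tilde H,\tilde H_\lambda\rangle=-i\lambda(\tilde H)$ for all $\tilde H\in\mathfrak H_0$. 3. The three subspaces $\mathbb R\tilde H_\lambda$, $\mathfrak G_{0,\lambda}$ and $\sum_{\alpha\in\Phi_\lambda}\mathfrak G_{0,\alpha}$ of $\mathfrak G_0$ are independent, and for every $u_\lambda\in U_\lambda$ $$\mathrm{ad}\,u_\lambda(U)\subseteq\mathbb R\tilde H_\lambda\oplus\mathfrak G_{0,\lambda}\oplus\sum_{\alpha\in\Phi_\lambda}\mathfrak G_{0,\alpha}.$$ 4. Equality holds in 3 for every $u_\lambda\in U_\lambda\setminus\Sigma'_\lambda$. -/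

import Mathlib

open scoped TensorProduct Pointwise

namespace TwoStepNilpotent

noncomputable section

/-! ### Complexification, weights and roots

Throughout, `𝔤₀` is a real Lie algebra, `M` a real `𝔤₀`-module and `𝔥₀` a Lie subalgebra of `𝔤₀`.
The complexifications are `ℂ ⊗[ℝ] 𝔤₀` and `ℂ ⊗[ℝ] M`; the case `M = 𝔤₀` is the adjoint module. -/

/-- The complex subalgebra `𝔥 = 𝔥₀^ℂ` of `𝔤 = 𝔤₀^ℂ`. -/
def complexify {𝔤₀ : Type*} [LieRing 𝔤₀] [LieAlgebra ℝ 𝔤₀] (𝔥₀ : LieSubalgebra ℝ 𝔤₀) :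
    LieSubalgebra ℂ (ℂ ⊗[ℝ] 𝔤₀) :=
  { 𝔥₀.toSubmodule.baseChange ℂ with
    lie_mem' := by
      intro x y hx hy
      change x ∈ 𝔥₀.toSubmodule.baseChange ℂ at hx
      change y ∈ 𝔥₀.toSubmodule.baseChange ℂ at hy
      change ⁅x, y⁆ ∈ 𝔥₀.toSubmodule.baseChange ℂ
      rw [Submodule.baseChange_eq_span] at hx hy
      refine Submodule.span_induction₂
        (p := fun x y _ _ => ⁅x, y⁆ ∈ 𝔥₀.toSubmodule.baseChange ℂ)
        ?_ ?_ ?_ ?_ ?_ ?_ ?_ hx hy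
      · rintro _ _ ⟨a, ha, rfl⟩ ⟨b, hb, rfl⟩
        simp only [TensorProduct.mk_apply, LieAlgebra.ExtendScalars.bracket_tmul]
        exact Submodule.tmul_mem_baseChange_of_mem _ (𝔥₀.lie_mem ha hb)
      · intro y _; simp
      · intro x _
        rw [show ⁅x, (0 : ℂ ⊗[ℝ] 𝔤₀)⁆ = 0 from lie_zero x]; exact zero_mem _
      · intro x y z _ _ _ h1 h2; rw [add_lie]; exact add_mem h1 h2
      · intro x y z _ _ _ h1 h2
        rw [show ⁅x, y + z⁆ = ⁅x, y⁆ + ⁅x, z⁆ from lie_add x y z]; exact add_mem h1 h2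
      · intro r x y _ _ h; rw [smul_lie]; exact Submodule.smul_mem _ _ h
      · intro r x y _ _ h
        rw [show ⁅x, r • y⁆ = r • ⁅x, y⁆ from lie_smul r x y]; exact Submodule.smul_mem _ _ h }

/-- The inclusion `𝔥₀ → 𝔥₀^ℂ`, `H ↦ 1 ⊗ H`. -/
def toComplexify {𝔤₀ : Type*} [LieRing 𝔤₀] [LieAlgebra ℝ 𝔤₀] (𝔥₀ : LieSubalgebra ℝ 𝔤₀)
    (H : 𝔥₀) : complexify 𝔥₀ :=
  ⟨(1 : ℂ) ⊗ₜ[ℝ] (H : 𝔤₀), Submodule.tmul_mem_baseChange_of_mem _ H.2⟩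

/-- The (complex) weight space `{v ∈ M^ℂ : H v = μ(H) v for all H ∈ 𝔥₀^ℂ}`.
For `M = 𝔤₀` and a root `μ` this is the root space of `μ`. -/
def wtSpace {𝔤₀ : Type*} [LieRing 𝔤₀] [LieAlgebra ℝ 𝔤₀] (𝔥₀ : LieSubalgebra ℝ 𝔤₀)
    (M : Type*) [AddCommGroup M] [Module ℝ M] [LieRingModule 𝔤₀ M] [LieModule ℝ 𝔤₀ M]
    (μ : Module.Dual ℂ (complexify 𝔥₀)) : Submodule ℂ (ℂ ⊗[ℝ] M) :=
  (LieModule.weightSpace (ℂ ⊗[ℝ] M) (μ : complexify 𝔥₀ → ℂ)).toSubmodule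

/-- The set of weights of `M^ℂ`: the nonzero functionals with nonzero weight space. -/
def weights {𝔤₀ : Type*} [LieRing 𝔤₀] [LieAlgebra ℝ 𝔤₀] (𝔥₀ : LieSubalgebra ℝ 𝔤₀)
    (M : Type*) [AddCommGroup M] [Module ℝ M] [LieRingModule 𝔤₀ M] [LieModule ℝ 𝔤₀ M] :
    Set (Module.Dual ℂ (complexify 𝔥₀)) :=
  {μ | μ ≠ 0 ∧ wtSpace 𝔥₀ M μ ≠ ⊥}

/-- The set `Φ` of roots: the weights of the adjoint module. -/
def roots {𝔤₀ : Type*} [LieRing 𝔤₀] [LieAlgebra ℝ 𝔤₀] (𝔥₀ : LieSubalgebra ℝ 𝔤₀) :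
    Set (Module.Dual ℂ (complexify 𝔥₀)) :=
  weights 𝔥₀ 𝔤₀

/-- The inclusion `M → M^ℂ`, `m ↦ 1 ⊗ m`. -/
def incl (M : Type*) [AddCommGroup M] [Module ℝ M] : M →ₗ[ℝ] ℂ ⊗[ℝ] M :=
  TensorProduct.mk ℝ ℂ M 1

/-- The conjugation `J` of `M^ℂ` determined by `M`: `z ⊗ m ↦ conj z ⊗ m`. -/
def conjugation (M : Type*) [AddCommGroup M] [Module ℝ M] : ℂ ⊗[ℝ] M →ₗ[ℝ] ℂ ⊗[ℝ] M :=
  LinearMap.rTensor M Complex.conjAe.toLinearMap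

/-- The real weight space `(V_μ + V_{-μ}) ∩ M`, where `V = M^ℂ`.
For `M = 𝔤₀` this is `𝔤_{0,μ} = (𝔤_μ + 𝔤_{-μ}) ∩ 𝔤₀`. -/
def realWtSpace {𝔤₀ : Type*} [LieRing 𝔤₀] [LieAlgebra ℝ 𝔤₀] (𝔥₀ : LieSubalgebra ℝ 𝔤₀)
    (M : Type*) [AddCommGroup M] [Module ℝ M] [LieRingModule 𝔤₀ M] [LieModule ℝ 𝔤₀ M]
    (μ : Module.Dual ℂ (complexify 𝔥₀)) : Submodule ℝ M :=
  ((wtSpace 𝔥₀ M μ ⊔ wtSpace 𝔥₀ M (-μ)).restrictScalars ℝ).comap (incl M)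

/-- `Φ_λ = {α ∈ Φ : V_{λ-α} ≠ 0}`. -/
def rootsAt {𝔤₀ : Type*} [LieRing 𝔤₀] [LieAlgebra ℝ 𝔤₀] (𝔥₀ : LieSubalgebra ℝ 𝔤₀)
    (M : Type*) [AddCommGroup M] [Module ℝ M] [LieRingModule 𝔤₀ M] [LieModule ℝ 𝔤₀ M]
    (μ : Module.Dual ℂ (complexify 𝔥₀)) : Set (Module.Dual ℂ (complexify 𝔥₀)) :=
  {α | α ∈ roots 𝔥₀ ∧ wtSpace 𝔥₀ M (μ - α) ≠ ⊥}

/-- The kernel in `V_μ` of a nonzero `X_{-α} ∈ 𝔤_{-α}`. Since root spaces are lines, this is the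
set of vectors of `V_μ` annihilated by all of `𝔤_{-α}`. -/
def rootKer {𝔤₀ : Type*} [LieRing 𝔤₀] [LieAlgebra ℝ 𝔤₀] (𝔥₀ : LieSubalgebra ℝ 𝔤₀)
    (M : Type*) [AddCommGroup M] [Module ℝ M] [LieRingModule 𝔤₀ M] [LieModule ℝ 𝔤₀ M]
    (μ α : Module.Dual ℂ (complexify 𝔥₀)) : Set (ℂ ⊗[ℝ] M) :=
  {v | v ∈ wtSpace 𝔥₀ M μ ∧ ∀ X ∈ wtSpace 𝔥₀ 𝔤₀ (-α), ⁅X, v⁆ = 0}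

/-- The exceptional set `Σ_μ ⊆ V_μ`: the union of the kernels of `X_{-α}`, `α ∈ Φ_μ`, together
with the kernel of `X_{-μ}` in case `μ` is a root. -/
def exceptional {𝔤₀ : Type*} [LieRing 𝔤₀] [LieAlgebra ℝ 𝔤₀] (𝔥₀ : LieSubalgebra ℝ 𝔤₀)
    (M : Type*) [AddCommGroup M] [Module ℝ M] [LieRingModule 𝔤₀ M] [LieModule ℝ 𝔤₀ M]
    (μ : Module.Dual ℂ (complexify 𝔥₀)) : Set (ℂ ⊗[ℝ] M) :=
  {v | μ ∈ roots 𝔥₀ ∧ v ∈ rootKer 𝔥₀ M μ μ} ∪ ⋃ α ∈ rootsAt 𝔥₀ M μ, rootKer 𝔥₀ M μ α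

/-- The exceptional set `Σ'_μ ⊆ U_μ`: the image of `Σ_μ` under `v ↦ v + J v`. -/
def realExceptional {𝔤₀ : Type*} [LieRing 𝔤₀] [LieAlgebra ℝ 𝔤₀] (𝔥₀ : LieSubalgebra ℝ 𝔤₀)
    (M : Type*) [AddCommGroup M] [Module ℝ M] [LieRingModule 𝔤₀ M] [LieModule ℝ 𝔤₀ M]
    (μ : Module.Dual ℂ (complexify 𝔥₀)) : Set (realWtSpace 𝔥₀ M μ) :=
  {u | ∃ v ∈ exceptional 𝔥₀ M μ, incl M (u : M) = v + conjugation M v}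

/-! ### Zariski closed subsets of a real vector space -/

/-- The algebra of polynomial functions on a real vector space: generated by linear functionals. -/
def polynomialFunctions (W : Type*) [AddCommGroup W] [Module ℝ W] : Subalgebra ℝ (W → ℝ) :=
  Algebra.adjoin ℝ (Set.range fun l : Module.Dual ℝ W => (l : W → ℝ))

/-- The common zero set of a family of polynomial functions. -/
def IsZariskiClosed {W : Type*} [AddCommGroup W] [Module ℝ W] (S : Set W) : Prop :=
  ∃ P : Set (W → ℝ), P ⊆ polynomialFunctions W ∧ S = {w | ∀ p ∈ P, p w = 0}

/-! ### The metric two-step nilpotent Lie algebra `𝔫₀ = U ⊕ 𝔤₀` -/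

/-- An inner product on `U ⊕ 𝔤₀` for which `U` and `𝔤₀` are orthogonal and every `X ∈ 𝔤₀` acts
skew symmetrically on `U` and on `𝔤₀`. -/
structure InvariantInnerProduct (𝔤₀ U : Type*) [LieRing 𝔤₀] [LieAlgebra ℝ 𝔤₀]
    [AddCommGroup U] [Module ℝ U] [LieRingModule 𝔤₀ U] [LieModule ℝ 𝔤₀ U] where
  form : LinearMap.BilinForm ℝ (U × 𝔤₀)
  symm : ∀ x y, form x y = form y x
  pos : ∀ x, x ≠ 0 → 0 < form x x
  orthogonal : ∀ (u : U) (X : 𝔤₀), form (u, 0) (0, X) = 0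
  skew_module : ∀ (X : 𝔤₀) (u v : U), form (⁅X, u⁆, 0) (v, 0) + form (u, 0) (⁅X, v⁆, 0) = 0
  skew_adjoint : ∀ X Y Z : 𝔤₀, form (0, ⁅X, Y⁆) (0, Z) + form (0, Y) (0, ⁅X, Z⁆) = 0

namespace InvariantInnerProduct

variable {𝔤₀ U : Type*} [LieRing 𝔤₀] [LieAlgebra ℝ 𝔤₀]
  [AddCommGroup U] [Module ℝ U] [LieRingModule 𝔤₀ U] [LieModule ℝ 𝔤₀ U]

/-- The restriction of the inner product to `𝔤₀`. -/
def formAlg (B : InvariantInnerProduct 𝔤₀ U) : LinearMap.BilinForm ℝ 𝔤₀ :=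
  B.form.compl₁₂ (LinearMap.inr ℝ U 𝔤₀) (LinearMap.inr ℝ U 𝔤₀)

theorem formAlg_nondegenerate (B : InvariantInnerProduct 𝔤₀ U) : B.formAlg.Nondegenerate := by
  have key : ∀ X : 𝔤₀, B.formAlg X X = 0 → X = 0 := by
    intro X hX
    by_contra hne
    have := B.pos (0, X) (by simpa [Prod.ext_iff] using hne)
    exact this.ne' hX
  exact ⟨fun X h => key X (h X), fun X h => key X (h X)⟩

/-- The functional `Z ↦ ⟨Z u, u'⟩` on `𝔤₀`, bilinearly in `u, u'`. -/
def moment (B : InvariantInnerProduct 𝔤₀ U) : U →ₗ[ℝ] U →ₗ[ℝ] Module.Dual ℝ 𝔤₀ :=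
  LinearMap.mk₂ ℝ
    (fun u u' =>
      { toFun := fun Z => B.form (⁅Z, u⁆, 0) (u', 0)
        map_add' := fun Z Z' => by
          rw [add_lie, ← LinearMap.add_apply, ← map_add]; simp
        map_smul' := fun r Z => by
          rw [smul_lie, RingHom.id_apply, ← LinearMap.smul_apply, ← map_smul]; simp })
    (fun u v w => by
      ext Z; simp only [LinearMap.coe_mk, AddHom.coe_mk, LinearMap.add_apply]
      rw [lie_add, ← LinearMap.add_apply, ← map_add]; simp)
    (fun r u w => by
      ext Z; simp only [LinearMap.coe_mk, AddHom.coe_mk, LinearMap.smul_apply]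
      rw [lie_smul, ← LinearMap.smul_apply, ← map_smul]; simp)
    (fun u v w => by
      ext Z; simp only [LinearMap.coe_mk, AddHom.coe_mk, LinearMap.add_apply]
      rw [← map_add]; simp)
    (fun r u w => by
      ext Z; simp only [LinearMap.coe_mk, AddHom.coe_mk, LinearMap.smul_apply]
      rw [← map_smul]; simp)

/-- The real vector space `𝔫₀ = U ⊕ 𝔤₀`; its Lie bracket, given below, is determined by the inner
product. -/
def Nil (_B : InvariantInnerProduct 𝔤₀ U) : Type _ := U × 𝔤₀

instance (B : InvariantInnerProduct 𝔤₀ U) : AddCommGroup B.Nil :=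
  inferInstanceAs (AddCommGroup (U × 𝔤₀))

instance (B : InvariantInnerProduct 𝔤₀ U) : Module ℝ B.Nil :=
  inferInstanceAs (Module ℝ (U × 𝔤₀))

/-- The inclusion `U → 𝔫₀`. -/
def inU (B : InvariantInnerProduct 𝔤₀ U) : U →ₗ[ℝ] B.Nil := LinearMap.inl ℝ U 𝔤₀

/-- The inclusion `𝔤₀ → 𝔫₀`. -/
def inG (B : InvariantInnerProduct 𝔤₀ U) : 𝔤₀ →ₗ[ℝ] B.Nil := LinearMap.inr ℝ U 𝔤₀

/-- The projection `𝔫₀ → U`. -/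
def prU (B : InvariantInnerProduct 𝔤₀ U) : B.Nil →ₗ[ℝ] U := LinearMap.fst ℝ U 𝔤₀

theorem prU_inG (B : InvariantInnerProduct 𝔤₀ U) (X : 𝔤₀) : B.prU (B.inG X) = 0 := rfl

variable [FiniteDimensional ℝ 𝔤₀]

/-- The element `[u, u'] ∈ 𝔤₀` defined by `⟨[u, u'], Z⟩ = ⟨Z u, u'⟩` for all `Z ∈ 𝔤₀`. -/
def bracketU (B : InvariantInnerProduct 𝔤₀ U) : U →ₗ[ℝ] U →ₗ[ℝ] 𝔤₀ :=
  B.moment.compr₂ (B.formAlg.toDual B.formAlg_nondegenerate).symm.toLinearMap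

theorem form_bracketU (B : InvariantInnerProduct 𝔤₀ U) (u u' : U) (Z : 𝔤₀) :
    B.form (0, B.bracketU u u') (0, Z) = B.form (⁅Z, u⁆, 0) (u', 0) :=
  LinearMap.BilinForm.apply_toDual_symm_apply (hB := B.formAlg_nondegenerate)
    (B.moment u u') Z

theorem bracketU_self (B : InvariantInnerProduct 𝔤₀ U) (u : U) : B.bracketU u u = 0 := by
  by_contra hne
  have h1 := B.pos (0, B.bracketU u u) (by simpa [Prod.ext_iff] using hne)
  have h2 := B.skew_module (B.bracketU u u) u u
  rw [B.symm (u, 0)] at h2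
  rw [B.form_bracketU] at h1
  linarith

/-- The bracket of `𝔫₀`: `𝔤₀` is central and `[u, u'] ∈ 𝔤₀` is as above. -/
instance (B : InvariantInnerProduct 𝔤₀ U) : LieRing B.Nil where
  bracket x y := B.inG (B.bracketU (B.prU x) (B.prU y))
  add_lie x y z := by simp only [map_add, LinearMap.add_apply]
  lie_add x y z := by simp only [map_add]
  lie_self x := by simp only [bracketU_self, map_zero]
  leibniz_lie x y z := by simp only [prU_inG, map_zero, LinearMap.zero_apply, add_zero]

instance (B : InvariantInnerProduct 𝔤₀ U) : LieAlgebra ℝ B.Nil where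
  lie_smul r x y := by
    change B.inG (B.bracketU (B.prU x) (B.prU (r • y))) =
      r • B.inG (B.bracketU (B.prU x) (B.prU y))
    simp only [map_smul]

/-- `H` is the real weight vector of `μ`: the element of `𝔥₀` with `⟨H', H⟩ = -i μ(H')` for all
`H' ∈ 𝔥₀`. -/
def IsRealWeightVector (B : InvariantInnerProduct 𝔤₀ U) (𝔥₀ : LieSubalgebra ℝ 𝔤₀)
    (μ : Module.Dual ℂ (complexify 𝔥₀)) (H : 𝔤₀) : Prop :=
  H ∈ 𝔥₀ ∧ ∀ H' : 𝔥₀,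
    ((B.form (0, (H' : 𝔤₀)) (0, H) : ℝ) : ℂ) = -Complex.I * μ (toComplexify 𝔥₀ H')

end InvariantInnerProduct

end

end TwoStepNilpotent

open TwoStepNilpotent

namespace TwoStepNilpotent

/-! ### Complexification and conjugation -/

section Conjugation

variable {M : Type*} [AddCommGroup M] [Module ℝ M]

/-! For `u` in `U`, the identity ⟨[u, u'], Z⟩ = ⟨Z u, u'⟩ shows that the orthogonal complement of ad
u(U) in `𝔤₀` is the annihilator {Z : Z u = 0} (`mem_orthogonal_range_bracketU`). Since double
orthogonals return the original subspaces, the theorem becomes a comparison of this annihilator with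
the orthogonal complement of the proposed range.

Write u = v + J v with v of weight `μ`, and expand 1 ⊗ Z into weight components f β. If Z is
orthogonal to the proposed range, then μ (f 0) = 0, and f β ≠ 0 with β ≠ 0 forces both μ + β and μ -
β to have zero weight space. So every component kills v and J v, and Z u = 0
(`lie_eq_zero_of_orthogonal`). Conversely let Z u = 0. The part of Z u of weight μ + β is f β v + f
(2μ + β) (J v). For β = 0, and for β = -α with α in Φ_μ, the hypotheses on 2μ make the second term
vanish. Hence μ (f 0) v = 0 and f (-α) v = 0. Since v is nonzero and lies in no kernel of a root
vector X_{-α}, both μ (f 0) and f (-α) are zero (`orthogonal_of_lie_eq_zero`).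

The choice α = β = μ in the hypothesis on sums shows that `μ` is not a root, so the middle summand
is zero and the exceptional set is a finite union of real subspaces. Each is proper because X_{-α}
acts nontrivially on V_μ (`exists_lie_ne_zero`), and a real vector space is not a finite union of
proper subspaces.

The structure theory required (semisimple action, root spaces being lines, nontrivial action of root
vectors) comes from positivity of the Hermitian form ⟨x, J y⟩, for which -J x acts as the adjoint of
x; no sl₂ theory enters. -/

theorem incl_apply (m : M) : incl M m = (1 : ℂ) ⊗ₜ[ℝ] m := rfl

theorem incl_smul (r : ℝ) (m : M) : incl M (r • m) = (r : ℂ) • incl M m := by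
  simp [incl_apply, TensorProduct.smul_tmul']

theorem conjugation_tmul (z : ℂ) (m : M) :
    conjugation M (z ⊗ₜ[ℝ] m) = (starRingEnd ℂ z) ⊗ₜ[ℝ] m := rfl

theorem conjugation_incl (m : M) : conjugation M (incl M m) = incl M m := by
  simp [incl_apply, conjugation_tmul]

theorem conjugation_conjugation (x : ℂ ⊗[ℝ] M) : conjugation M (conjugation M x) = x := by
  induction x with
  | zero => simp
  | tmul z m => simp [conjugation_tmul]
  | add x y hx hy => rw [map_add, map_add, hx, hy]

theorem conjugation_smul (c : ℂ) (x : ℂ ⊗[ℝ] M) :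
    conjugation M (c • x) = starRingEnd ℂ c • conjugation M x := by
  induction x with
  | zero => simp
  | tmul z m => simp [conjugation_tmul, TensorProduct.smul_tmul']
  | add x y hx hy => rw [smul_add, map_add, hx, hy, map_add, smul_add]

theorem exists_eq_incl_add_smul_incl (x : ℂ ⊗[ℝ] M) :
    ∃ a b : M, x = incl M a + Complex.I • incl M b := by
  induction x with
  | zero => exact ⟨0, 0, by simp⟩
  | tmul z m =>
    refine ⟨z.re • m, z.im • m, ?_⟩
    simp only [incl_apply, TensorProduct.smul_tmul', ← TensorProduct.smul_tmul,
      ← TensorProduct.add_tmul]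
    congr 1
    apply Complex.ext <;> simp
  | add x y hx hy =>
    obtain ⟨a, b, rfl⟩ := hx
    obtain ⟨c, d, rfl⟩ := hy
    exact ⟨a + c, b + d, by simp only [map_add, smul_add]; abel⟩

theorem exists_incl_eq_of_conjugation_eq {x : ℂ ⊗[ℝ] M} (hx : conjugation M x = x) :
    ∃ m : M, incl M m = x := by
  obtain ⟨a, b, rfl⟩ := exists_eq_incl_add_smul_incl x
  refine ⟨a, ?_⟩
  rw [map_add, conjugation_smul, conjugation_incl, conjugation_incl, Complex.conj_I, neg_smul,
    add_right_inj] at hx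
  have h : (2 : ℂ) • (Complex.I • incl M b) = 0 := by
    rw [two_smul]; nth_rewrite 1 [← hx]; simp
  rw [(smul_eq_zero.mp h).resolve_left two_ne_zero, add_zero]

end Conjugation

/-! ### The action of the complexified algebra and its compatibility with conjugation. -/

section Bracket

variable {𝔤₀ M : Type*} [LieRing 𝔤₀] [LieAlgebra ℝ 𝔤₀]
  [AddCommGroup M] [Module ℝ M] [LieRingModule 𝔤₀ M] [LieModule ℝ 𝔤₀ M]

theorem complexified_lie_add (x : ℂ ⊗[ℝ] 𝔤₀) (m n : ℂ ⊗[ℝ] M) : ⁅x, m + n⁆ = ⁅x, m⁆ + ⁅x, n⁆ :=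
  lie_add x m n

theorem complexified_lie_smul (x : ℂ ⊗[ℝ] 𝔤₀) (c : ℂ) (m : ℂ ⊗[ℝ] M) : ⁅x, c • m⁆ = c • ⁅x, m⁆ :=
  lie_smul c x m

theorem complexified_smul_lie (c : ℂ) (x : ℂ ⊗[ℝ] 𝔤₀) (m : ℂ ⊗[ℝ] M) : ⁅c • x, m⁆ = c • ⁅x, m⁆ :=
  smul_lie c x m

theorem complexified_lie_zero (x : ℂ ⊗[ℝ] 𝔤₀) : ⁅x, (0 : ℂ ⊗[ℝ] M)⁆ = 0 :=
  lie_zero x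

theorem complexified_zero_lie (m : ℂ ⊗[ℝ] M) : ⁅(0 : ℂ ⊗[ℝ] 𝔤₀), m⁆ = 0 :=
  zero_lie m

theorem conjugation_lie (x : ℂ ⊗[ℝ] 𝔤₀) (m : ℂ ⊗[ℝ] M) :
    conjugation M ⁅x, m⁆ = ⁅conjugation 𝔤₀ x, conjugation M m⁆ := by
  induction x with
  | zero => simp
  | tmul z X =>
    induction m with
    | zero => simp [complexified_lie_zero]
    | tmul w m => simp [conjugation_tmul, LieAlgebra.ExtendScalars.bracket_tmul]
    | add x y hx hy => rw [complexified_lie_add, map_add, hx, hy, map_add, complexified_lie_add]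
  | add x y hx hy => rw [add_lie, map_add, hx, hy, map_add, add_lie]

theorem incl_lie (X : 𝔤₀) (m : M) : incl M ⁅X, m⁆ = ⁅incl 𝔤₀ X, incl M m⁆ := by
  simp [incl_apply, LieAlgebra.ExtendScalars.bracket_tmul]

theorem complexified_lie_skew (x y : ℂ ⊗[ℝ] 𝔤₀) : -⁅y, x⁆ = ⁅x, y⁆ := lie_skew x y

theorem complexified_lie_lie (x y : ℂ ⊗[ℝ] 𝔤₀) (m : ℂ ⊗[ℝ] M) :
    ⁅⁅x, y⁆, m⁆ = ⁅x, ⁅y, m⁆⁆ - ⁅y, ⁅x, m⁆⁆ := by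
  rw [leibniz_lie x y m]; abel

end Bracket

/-! ### Invariant inner products on modules and their complexifications -/

/-- An inner product on a real `𝔤₀`-module `M` for which `𝔤₀` acts by skew-symmetric maps. -/
structure InvForm (𝔤₀ M : Type*) [LieRing 𝔤₀] [LieAlgebra ℝ 𝔤₀]
    [AddCommGroup M] [Module ℝ M] [LieRingModule 𝔤₀ M] [LieModule ℝ 𝔤₀ M] where
  form : LinearMap.BilinForm ℝ M
  symm : ∀ x y, form x y = form y x
  pos : ∀ x, x ≠ 0 → 0 < form x x
  skew : ∀ (X : 𝔤₀) (m n : M), form ⁅X, m⁆ n + form m ⁅X, n⁆ = 0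

namespace InvForm

section

variable {𝔤₀ M : Type*} [LieRing 𝔤₀] [LieAlgebra ℝ 𝔤₀]
  [AddCommGroup M] [Module ℝ M] [LieRingModule 𝔤₀ M] [LieModule ℝ 𝔤₀ M]

/-- The complex bilinear extension of an invariant inner product. -/
noncomputable def complexForm (b : InvForm 𝔤₀ M) : LinearMap.BilinForm ℂ (ℂ ⊗[ℝ] M) :=
  b.form.baseChange ℂ

theorem complexForm_tmul (b : InvForm 𝔤₀ M) (z w : ℂ) (m n : M) :
    b.complexForm (z ⊗ₜ m) (w ⊗ₜ n) = w * z * (b.form m n : ℂ) := by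
  simp [complexForm, LinearMap.BilinForm.baseChange_tmul, mul_comm]

theorem complexForm_incl (b : InvForm 𝔤₀ M) (m n : M) :
    b.complexForm (incl M m) (incl M n) = (b.form m n : ℂ) := by
  simp [incl_apply, complexForm_tmul]

theorem complexForm_symm (b : InvForm 𝔤₀ M) (x y : ℂ ⊗[ℝ] M) :
    b.complexForm x y = b.complexForm y x := by
  induction x with
  | zero => simp
  | tmul z m =>
    induction y with
    | zero => simp
    | tmul w n => rw [complexForm_tmul, complexForm_tmul, b.symm m n, mul_comm w z]
    | add x y hx hy => rw [map_add, hx, hy, map_add, LinearMap.add_apply]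
  | add x y hx hy => rw [map_add, LinearMap.add_apply, hx, hy, map_add]

theorem complexForm_conjugation (b : InvForm 𝔤₀ M) (x y : ℂ ⊗[ℝ] M) :
    b.complexForm (conjugation M x) (conjugation M y) = starRingEnd ℂ (b.complexForm x y) := by
  induction x with
  | zero => simp
  | tmul z m =>
    induction y with
    | zero => simp
    | tmul w n => simp [conjugation_tmul, complexForm_tmul]
    | add x y hx hy => simp only [map_add, hx, hy]
  | add x y hx hy => simp only [map_add, LinearMap.add_apply, hx, hy]

theorem complexForm_lie (b : InvForm 𝔤₀ M) (x : ℂ ⊗[ℝ] 𝔤₀) (m n : ℂ ⊗[ℝ] M) :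
    b.complexForm ⁅x, m⁆ n = - b.complexForm m ⁅x, n⁆ := by
  induction x with
  | zero => simp
  | tmul z X =>
    induction m with
    | zero => simp [complexified_lie_zero]
    | tmul w m =>
      induction n with
      | zero => simp [complexified_lie_zero]
      | tmul v n =>
        simp only [LieAlgebra.ExtendScalars.bracket_tmul, complexForm_tmul]
        rw [eq_neg_of_add_eq_zero_left (b.skew X m n)]
        push_cast; ring
      | add x y hx hy => rw [map_add, hx, hy, complexified_lie_add, map_add]; ring
    | add x y hx hy =>
      rw [complexified_lie_add, map_add, LinearMap.add_apply, hx, hy, map_add, LinearMap.add_apply]; ring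
  | add x y hx hy =>
    rw [add_lie, map_add, LinearMap.add_apply, hx, hy, add_lie, map_add]; ring

theorem nonneg (b : InvForm 𝔤₀ M) (m : M) : 0 ≤ b.form m m := by
  by_cases h : m = 0
  · simp [h]
  · exact (b.pos m h).le

/-- For x = m + i n the value is |m|² + |n|²; the cross terms cancel by symmetry. The existential
packages both reality and positivity of the complex number. -/
theorem hermitian_pos (b : InvForm 𝔤₀ M) {x : ℂ ⊗[ℝ] M} (hx : x ≠ 0) :
    ∃ r : ℝ, 0 < r ∧ b.complexForm x (conjugation M x) = r := by
  obtain ⟨m, n, rfl⟩ := exists_eq_incl_add_smul_incl x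
  refine ⟨b.form m m + b.form n n, ?_, ?_⟩
  · by_cases hm : m = 0
    · have hn : n ≠ 0 := by rintro rfl; simp [hm] at hx
      linarith [b.pos n hn, b.nonneg m]
    · linarith [b.pos m hm, b.nonneg n]
  · simp only [map_add, conjugation_smul, conjugation_incl, LinearMap.add_apply, map_smul,
      LinearMap.smul_apply, complexForm_incl, smul_eq_mul, Complex.conj_I]
    rw [b.symm n m]
    push_cast
    linear_combination (-(b.form n n : ℂ)) * Complex.I_mul_I

theorem hermitian_nonneg (b : InvForm 𝔤₀ M) (x : ℂ ⊗[ℝ] M) :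
    ∃ r : ℝ, 0 ≤ r ∧ b.complexForm x (conjugation M x) = r := by
  by_cases hx : x = 0
  · exact ⟨0, le_rfl, by simp [hx]⟩
  · obtain ⟨r, h, h'⟩ := b.hermitian_pos hx
    exact ⟨r, h.le, h'⟩

theorem eq_zero_of_hermitian_eq_zero (b : InvForm 𝔤₀ M) {x : ℂ ⊗[ℝ] M}
    (h : b.complexForm x (conjugation M x) = 0) : x = 0 := by
  by_contra hx
  obtain ⟨r, hr, h'⟩ := b.hermitian_pos hx
  rw [h] at h'
  exact hr.ne (by exact_mod_cast h')

theorem incl_injective (b : InvForm 𝔤₀ M) {m : M} (h : incl M m = 0) : m = 0 := by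
  by_contra hm
  have := b.complexForm_incl m m
  rw [h, map_zero] at this
  exact (b.pos m hm).ne (by exact_mod_cast this)

end

end InvForm

/-! ### Weight spaces -/

section Weights

variable {𝔤₀ M : Type*} [LieRing 𝔤₀] [LieAlgebra ℝ 𝔤₀]
  [AddCommGroup M] [Module ℝ M] [LieRingModule 𝔤₀ M] [LieModule ℝ 𝔤₀ M]
  {𝔥₀ : LieSubalgebra ℝ 𝔤₀}

theorem exists_eq_toComplexify_add (h : complexify 𝔥₀) :
    ∃ a b : 𝔥₀, h = toComplexify 𝔥₀ a + Complex.I • toComplexify 𝔥₀ b := by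
  obtain ⟨x, hx⟩ := h
  suffices ∃ a b : 𝔥₀, x = incl 𝔤₀ a + Complex.I • incl 𝔤₀ b by
    obtain ⟨a, b, h⟩ := this
    exact ⟨a, b, Subtype.ext h⟩
  change x ∈ 𝔥₀.toSubmodule.baseChange ℂ at hx
  rw [Submodule.baseChange_eq_span] at hx
  induction hx using Submodule.span_induction with
  | mem x hx =>
    obtain ⟨a, ha, rfl⟩ := hx
    exact ⟨⟨a, ha⟩, 0, by simp [incl_apply]⟩
  | zero => exact ⟨0, 0, by simp⟩
  | add x y _ _ hx hy =>
    obtain ⟨a, b, rfl⟩ := hx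
    obtain ⟨c, d, rfl⟩ := hy
    refine ⟨a + c, b + d, ?_⟩
    rw [show ((a + c : 𝔥₀) : 𝔤₀) = a + c from rfl, show ((b + d : 𝔥₀) : 𝔤₀) = b + d from rfl]
    simp only [map_add, smul_add]; abel
  | smul z x _ hx =>
    obtain ⟨a, b, rfl⟩ := hx
    refine ⟨z.re • a - z.im • b, z.re • b + z.im • a, ?_⟩
    rw [show ((z.re • a - z.im • b : 𝔥₀) : 𝔤₀) = z.re • (a : 𝔤₀) - z.im • (b : 𝔤₀) from rfl,
      show ((z.re • b + z.im • a : 𝔥₀) : 𝔤₀) = z.re • (b : 𝔤₀) + z.im • (a : 𝔤₀) from rfl]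
    simp only [map_add, map_sub, incl_smul]
    nth_rewrite 1 [← Complex.re_add_im z]
    generalize (z.re : ℂ) = p, (z.im : ℂ) = q
    match_scalars
    · ring
    · linear_combination q * Complex.I_mul_I

theorem mem_wtSpace_iff {μ : Module.Dual ℂ (complexify 𝔥₀)} {x : ℂ ⊗[ℝ] M} :
    x ∈ wtSpace 𝔥₀ M μ ↔ ∀ H : 𝔥₀, ⁅incl 𝔤₀ (H : 𝔤₀), x⁆ = μ (toComplexify 𝔥₀ H) • x := by
  rw [wtSpace, LieSubmodule.mem_toSubmodule, LieModule.mem_weightSpace]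
  constructor
  · intro h H; exact h (toComplexify 𝔥₀ H)
  · intro h y
    obtain ⟨a, b, rfl⟩ := exists_eq_toComplexify_add y
    have ha : ⁅toComplexify 𝔥₀ a, x⁆ = _ := h a
    have hb : ⁅toComplexify 𝔥₀ b, x⁆ = _ := h b
    rw [add_lie, smul_lie, ha, hb, map_add, map_smul, add_smul, smul_smul, smul_eq_mul]

theorem lie_of_mem_wtSpace {μ : Module.Dual ℂ (complexify 𝔥₀)} {x : ℂ ⊗[ℝ] M}
    (hx : x ∈ wtSpace 𝔥₀ M μ) (h : complexify 𝔥₀) : ⁅(h : ℂ ⊗[ℝ] 𝔤₀), x⁆ = μ h • x := by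
  rw [wtSpace, LieSubmodule.mem_toSubmodule, LieModule.mem_weightSpace] at hx
  exact hx h

theorem exists_toComplexify_ne_zero {μ : Module.Dual ℂ (complexify 𝔥₀)} (hμ : μ ≠ 0) :
    ∃ H : 𝔥₀, μ (toComplexify 𝔥₀ H) ≠ 0 := by
  by_contra! h
  apply hμ
  ext y
  obtain ⟨a, b, rfl⟩ := exists_eq_toComplexify_add y
  simp [h]

theorem lie_mem_wtSpace {α μ : Module.Dual ℂ (complexify 𝔥₀)} {x : ℂ ⊗[ℝ] 𝔤₀} {m : ℂ ⊗[ℝ] M}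
    (hx : x ∈ wtSpace 𝔥₀ 𝔤₀ α) (hm : m ∈ wtSpace 𝔥₀ M μ) : ⁅x, m⁆ ∈ wtSpace 𝔥₀ M (α + μ) := by
  rw [mem_wtSpace_iff] at *
  intro H
  rw [leibniz_lie, hm H]
  have : ⁅incl 𝔤₀ (H : 𝔤₀), x⁆ = _ := hx H
  rw [this, complexified_smul_lie, complexified_lie_smul, LinearMap.add_apply, add_smul]

theorem eq_zero_of_mem_wtSpace {μ ν : Module.Dual ℂ (complexify 𝔥₀)} (hne : μ ≠ ν)
    {x : ℂ ⊗[ℝ] M} (hx : x ∈ wtSpace 𝔥₀ M μ) (hx' : x ∈ wtSpace 𝔥₀ M ν) : x = 0 := by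
  obtain ⟨H, hH⟩ := exists_toComplexify_ne_zero (sub_ne_zero.mpr hne)
  have h : (μ - ν) (toComplexify 𝔥₀ H) • x = 0 := by
    rw [LinearMap.sub_apply, sub_smul, ← mem_wtSpace_iff.mp hx H, ← mem_wtSpace_iff.mp hx' H,
      sub_self]
  exact (smul_eq_zero.mp h).resolve_left hH

theorem isLieAbelian_complexify [IsLieAbelian 𝔥₀] : IsLieAbelian (complexify 𝔥₀) := by
  have key : ∀ a b : 𝔥₀, ⁅toComplexify 𝔥₀ a, toComplexify 𝔥₀ b⁆ = 0 := by
    intro a b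
    have h0 : ⁅(a : 𝔤₀), (b : 𝔤₀)⁆ = 0 := congrArg Subtype.val (trivial_lie_zero 𝔥₀ 𝔥₀ a b)
    apply Subtype.ext
    change ⁅incl 𝔤₀ (a : 𝔤₀), incl 𝔤₀ (b : 𝔤₀)⁆ = 0
    rw [← incl_lie, h0, map_zero]
  refine ⟨fun x y => ?_⟩
  obtain ⟨a, b, rfl⟩ := exists_eq_toComplexify_add x
  obtain ⟨c, d, rfl⟩ := exists_eq_toComplexify_add y
  simp only [add_lie, lie_add, smul_lie, lie_smul, key, smul_zero, add_zero]

theorem finite_weights (M : Type*) [AddCommGroup M] [Module ℝ M] [LieRingModule 𝔤₀ M]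
    [LieModule ℝ 𝔤₀ M] [FiniteDimensional ℝ M] [IsLieAbelian 𝔥₀] : (weights 𝔥₀ M).Finite := by
  have := isLieAbelian_complexify (𝔥₀ := 𝔥₀)
  have h := LieModule.finite_genWeightSpace_ne_bot ℂ (complexify 𝔥₀) (ℂ ⊗[ℝ] M)
  refine Set.Finite.subset (h.preimage (f := fun μ : Module.Dual ℂ (complexify 𝔥₀) => ⇑μ)
    DFunLike.coe_injective.injOn) ?_
  rintro μ ⟨_, hμ⟩ h0
  apply hμ
  rw [wtSpace, LieSubmodule.toSubmodule_eq_bot, eq_bot_iff, ← h0]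
  exact LieModule.weightSpace_le_genWeightSpace _ _

namespace InvForm

/-- Elements of `𝔥₀` are real and skew, hence skew-Hermitian on the complexification, so their
eigenvalues are purely imaginary. This is what makes `J` exchange the weights μ and -μ. -/
theorem weight_imaginary (b : InvForm 𝔤₀ M) {μ : Module.Dual ℂ (complexify 𝔥₀)}
    {x : ℂ ⊗[ℝ] M} (hx : x ∈ wtSpace 𝔥₀ M μ) (h0 : x ≠ 0) (H : 𝔥₀) :
    starRingEnd ℂ (μ (toComplexify 𝔥₀ H)) = - μ (toComplexify 𝔥₀ H) := by
  obtain ⟨r, hr, h⟩ := b.hermitian_pos h0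
  have h1 := b.complexForm_lie (incl 𝔤₀ (H : 𝔤₀)) x (conjugation M x)
  have h2 : ⁅incl 𝔤₀ (H : 𝔤₀), conjugation M x⁆ =
      starRingEnd ℂ (μ (toComplexify 𝔥₀ H)) • conjugation M x := by
    rw [← conjugation_smul, ← mem_wtSpace_iff.mp hx H, conjugation_lie, conjugation_incl]
  rw [h2, mem_wtSpace_iff.mp hx H, map_smul, map_smul, LinearMap.smul_apply, h, smul_eq_mul,
    smul_eq_mul, ← neg_mul] at h1
  have := mul_right_cancel₀ (by exact_mod_cast hr.ne') h1
  exact (neg_eq_iff_eq_neg.mpr this).symm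

theorem conjugation_mem_wtSpace (b : InvForm 𝔤₀ M) {μ : Module.Dual ℂ (complexify 𝔥₀)}
    {x : ℂ ⊗[ℝ] M} (hx : x ∈ wtSpace 𝔥₀ M μ) : conjugation M x ∈ wtSpace 𝔥₀ M (-μ) := by
  by_cases h0 : x = 0
  · simp [h0]
  rw [mem_wtSpace_iff]
  intro H
  rw [LinearMap.neg_apply, ← b.weight_imaginary hx h0, ← conjugation_smul,
    ← mem_wtSpace_iff.mp hx H, conjugation_lie, conjugation_incl]

theorem wtSpace_neg_eq_bot_iff (b : InvForm 𝔤₀ M) {μ : Module.Dual ℂ (complexify 𝔥₀)} :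
    wtSpace 𝔥₀ M (-μ) = ⊥ ↔ wtSpace 𝔥₀ M μ = ⊥ := by
  have key : ∀ ν : Module.Dual ℂ (complexify 𝔥₀), wtSpace 𝔥₀ M (-ν) = ⊥ → wtSpace 𝔥₀ M ν = ⊥ := by
    intro ν h
    rw [Submodule.eq_bot_iff] at h ⊢
    intro x hx
    rw [← conjugation_conjugation x, h _ (b.conjugation_mem_wtSpace hx), map_zero]
  exact ⟨key μ, fun h => key (-μ) (by rwa [neg_neg])⟩

theorem neg_mem_roots (b : InvForm 𝔤₀ 𝔤₀) {α : Module.Dual ℂ (complexify 𝔥₀)}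
    (hα : α ∈ roots 𝔥₀) : -α ∈ roots 𝔥₀ :=
  ⟨neg_ne_zero.mpr hα.1, fun h => hα.2 (b.wtSpace_neg_eq_bot_iff.mp h)⟩

theorem complexForm_eq_zero (b : InvForm 𝔤₀ M) {μ ν : Module.Dual ℂ (complexify 𝔥₀)}
    (hne : μ + ν ≠ 0) {x y : ℂ ⊗[ℝ] M} (hx : x ∈ wtSpace 𝔥₀ M μ) (hy : y ∈ wtSpace 𝔥₀ M ν) :
    b.complexForm x y = 0 := by
  obtain ⟨H, hH⟩ := exists_toComplexify_ne_zero hne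
  have h := b.complexForm_lie (incl 𝔤₀ (H : 𝔤₀)) x y
  rw [mem_wtSpace_iff.mp hx H, mem_wtSpace_iff.mp hy H, map_smul, map_smul, LinearMap.smul_apply,
    smul_eq_mul, smul_eq_mul] at h
  have h' : (μ + ν) (toComplexify 𝔥₀ H) * b.complexForm x y = 0 := by
    rw [LinearMap.add_apply]; linear_combination h
  exact (mul_eq_zero.mp h').resolve_left hH

/-- Each `X ∈ 𝔤₀` acts semisimply on `M^ℂ`. -/
theorem eigenvector_of_lie_sub_pow (b : InvForm 𝔤₀ M) (X : 𝔤₀) (c : ℂ) (k : ℕ) (x : ℂ ⊗[ℝ] M)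
    (h : ((LieModule.toEnd ℂ (ℂ ⊗[ℝ] 𝔤₀) (ℂ ⊗[ℝ] M) (incl 𝔤₀ X) - algebraMap ℂ _ c) ^ k) x = 0) :
    ⁅incl 𝔤₀ X, x⁆ = c • x := by
  set T := LieModule.toEnd ℂ (ℂ ⊗[ℝ] 𝔤₀) (ℂ ⊗[ℝ] M) (incl 𝔤₀ X) - algebraMap ℂ _ c with hT
  have hTx : ∀ y, T y = ⁅incl 𝔤₀ X, y⁆ - c • y := fun y => rfl
  have hconj : ∀ y, ⁅incl 𝔤₀ X, conjugation M y⁆ = conjugation M ⁅incl 𝔤₀ X, y⁆ := fun y => by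
    rw [conjugation_lie, conjugation_incl]
  -- Put w = T y, an eigenvector for c. If w ≠ 0, skewness gives c + conj c = 0, and then ⟨w, J w⟩ =
  -- -(c + conj c) ⟨y, J w⟩ = 0, a contradiction. So T has no Jordan block of size two.
  have key : ∀ y, T (T y) = 0 → T y = 0 := by
    intro y hy
    by_contra hw
    set w := T y with hw'
    have hXw : ⁅incl 𝔤₀ X, w⁆ = c • w := by rw [hTx] at hy; exact sub_eq_zero.mp hy
    obtain ⟨r, hr, hrw⟩ := b.hermitian_pos hw
    have h1 := b.complexForm_lie (incl 𝔤₀ X) w (conjugation M w)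
    rw [hconj, hXw, conjugation_smul, map_smul, map_smul, LinearMap.smul_apply, hrw, smul_eq_mul,
      smul_eq_mul] at h1
    have hc : starRingEnd ℂ c + c = 0 := by
      have : (r : ℂ) ≠ 0 := by exact_mod_cast hr.ne'
      apply mul_right_cancel₀ this
      linear_combination h1
    have h2 := b.complexForm_lie (incl 𝔤₀ X) y (conjugation M w)
    rw [hconj, hXw, conjugation_smul, map_smul, smul_eq_mul] at h2
    have h3 : b.complexForm w (conjugation M w) = 0 := by
      nth_rewrite 1 [hw']
      rw [hTx, map_sub, LinearMap.sub_apply, h2, map_smul, LinearMap.smul_apply, smul_eq_mul]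
      linear_combination (-b.complexForm y (conjugation M w)) * hc
    exact hw (b.eq_zero_of_hermitian_eq_zero h3)
  have hall : ∀ (k : ℕ) (y), (T ^ k) y = 0 → T y = 0 := by
    intro k
    induction k with
    | zero => intro y hy; simp only [pow_zero, Module.End.one_apply] at hy; simp [hy]
    | succ k ih =>
      intro y hy
      rw [pow_succ, Module.End.mul_apply] at hy
      exact key y (ih _ hy)
  exact sub_eq_zero.mp ((hTx x).symm.trans (hall k x h))

theorem iSup_wtSpace (b : InvForm 𝔤₀ M) [FiniteDimensional ℝ M] [FiniteDimensional ℝ 𝔤₀]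
    [IsLieAbelian 𝔥₀] : ⨆ μ, wtSpace 𝔥₀ M μ = ⊤ := by
  have := isLieAbelian_complexify (𝔥₀ := 𝔥₀)
  have htop := LieModule.iSup_genWeightSpace_eq_top' ℂ (complexify 𝔥₀) (ℂ ⊗[ℝ] M)
  rw [← LieSubmodule.toSubmodule_inj, LieSubmodule.iSup_toSubmodule,
    LieSubmodule.top_toSubmodule] at htop
  rw [eq_top_iff, ← htop]
  refine iSup_le fun χ => ?_
  -- Generalized weight spaces are genuine ones, because each element of `𝔥₀` acts semisimply.
  refine le_trans ?_ (le_iSup (wtSpace 𝔥₀ M) (LieModule.Weight.toLinear ℂ _ _ χ))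
  intro x hx
  rw [mem_wtSpace_iff]
  intro H
  rw [LieSubmodule.mem_toSubmodule, LieModule.mem_genWeightSpace] at hx
  obtain ⟨k, hk⟩ := hx (toComplexify 𝔥₀ H)
  exact b.eigenvector_of_lie_sub_pow H _ k x hk

/-- Decomposition of a vector into weight vectors. -/
theorem exists_weight_decomposition (b : InvForm 𝔤₀ M) [FiniteDimensional ℝ M]
    [FiniteDimensional ℝ 𝔤₀] [IsLieAbelian 𝔥₀] (x : ℂ ⊗[ℝ] M) :
    ∃ f : Module.Dual ℂ (complexify 𝔥₀) →₀ ℂ ⊗[ℝ] M, (∀ μ, f μ ∈ wtSpace 𝔥₀ M μ) ∧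
      x = ∑ μ ∈ f.support, f μ := by
  have hx : x ∈ ⨆ μ, wtSpace 𝔥₀ M μ := by rw [b.iSup_wtSpace]; trivial
  obtain ⟨f, hf, h⟩ := (Submodule.mem_iSup_iff_exists_finsupp _ _).mp hx
  exact ⟨f, hf, h.symm⟩

end InvForm

end Weights

/-! ### Root spaces of a compact Lie algebra -/

section Roots

variable {𝔤₀ M : Type*} [LieRing 𝔤₀] [LieAlgebra ℝ 𝔤₀]
  [AddCommGroup M] [Module ℝ M] [LieRingModule 𝔤₀ M] [LieModule ℝ 𝔤₀ M]
  {𝔥₀ : LieSubalgebra ℝ 𝔤₀}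

theorem lie_eq_zero_of_isLieAbelian [IsLieAbelian 𝔥₀] {a b : 𝔤₀} (ha : a ∈ 𝔥₀) (hb : b ∈ 𝔥₀) :
    ⁅a, b⁆ = 0 :=
  congrArg Subtype.val (trivial_lie_zero 𝔥₀ 𝔥₀ ⟨a, ha⟩ ⟨b, hb⟩)

theorem mem_of_maximal_of_lie_eq_zero
    (hmax : Maximal (fun K : LieSubalgebra ℝ 𝔤₀ => IsLieAbelian K) 𝔥₀) {a : 𝔤₀}
    (ha : ∀ H : 𝔥₀, ⁅(H : 𝔤₀), a⁆ = 0) : a ∈ 𝔥₀ := by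
  have := hmax.prop
  have key : ∀ x ∈ 𝔥₀.toSubmodule ⊔ Submodule.span ℝ {a},
      ∀ y ∈ 𝔥₀.toSubmodule ⊔ Submodule.span ℝ {a}, ⁅x, y⁆ = 0 := by
    intro x hx y hy
    obtain ⟨p, hp, q, hq, rfl⟩ := Submodule.mem_sup.mp hx
    obtain ⟨p', hp', q', hq', rfl⟩ := Submodule.mem_sup.mp hy
    obtain ⟨s, rfl⟩ := Submodule.mem_span_singleton.mp hq
    obtain ⟨s', rfl⟩ := Submodule.mem_span_singleton.mp hq'
    have h1 : ⁅p, p'⁆ = 0 := lie_eq_zero_of_isLieAbelian (𝔥₀ := 𝔥₀) hp hp'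
    have h2 : ⁅p, a⁆ = 0 := ha ⟨p, hp⟩
    have h3 : ⁅a, p'⁆ = 0 := by rw [← lie_skew, show ⁅p', a⁆ = 0 from ha ⟨p', hp'⟩, neg_zero]
    simp [h1, h2, h3]
  let K : LieSubalgebra ℝ 𝔤₀ :=
    { 𝔥₀.toSubmodule ⊔ Submodule.span ℝ {a} with
      lie_mem' := fun {x y} hx hy => by
        rw [key x hx y hy]
        exact zero_mem (𝔥₀.toSubmodule ⊔ Submodule.span ℝ {a}) }
  have hK : IsLieAbelian K := ⟨fun x y => Subtype.ext (key x x.2 y y.2)⟩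
  have hle : 𝔥₀ ≤ K := fun x hx => Submodule.mem_sup_left (S := 𝔥₀.toSubmodule) hx
  exact hmax.le_of_ge hK hle (Submodule.mem_sup_right (Submodule.mem_span_singleton_self a))

theorem coe_mem_wtSpace_zero [IsLieAbelian 𝔥₀] (h : complexify 𝔥₀) :
    (h : ℂ ⊗[ℝ] 𝔤₀) ∈ wtSpace 𝔥₀ 𝔤₀ 0 := by
  have := isLieAbelian_complexify (𝔥₀ := 𝔥₀)
  rw [mem_wtSpace_iff]
  intro H
  rw [LinearMap.zero_apply, zero_smul]
  exact congrArg Subtype.val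
    (trivial_lie_zero (complexify 𝔥₀) (complexify 𝔥₀) (toComplexify 𝔥₀ H) h)

namespace InvForm

/-- Weight zero is stable under `J`, so the real and imaginary parts of x both centralize `𝔥₀`. By
maximality they lie in `𝔥₀`. -/
theorem exists_coe_eq_of_mem_wtSpace_zero (b : InvForm 𝔤₀ 𝔤₀)
    (hmax : Maximal (fun K : LieSubalgebra ℝ 𝔤₀ => IsLieAbelian K) 𝔥₀) {x : ℂ ⊗[ℝ] 𝔤₀}
    (hx : x ∈ wtSpace 𝔥₀ 𝔤₀ 0) : ∃ h : complexify 𝔥₀, (h : ℂ ⊗[ℝ] 𝔤₀) = x := by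
  have key : ∀ y ∈ wtSpace 𝔥₀ 𝔤₀ 0, ∀ H : 𝔥₀, ⁅incl 𝔤₀ (H : 𝔤₀), y⁆ = 0 := fun y hy H => by
    rw [mem_wtSpace_iff.mp hy H]; simp
  obtain ⟨m, n, rfl⟩ := exists_eq_incl_add_smul_incl x
  have hJ := b.conjugation_mem_wtSpace hx
  rw [neg_zero] at hJ
  have hmn : ∀ H : 𝔥₀, ⁅(H : 𝔤₀), m⁆ = 0 ∧ ⁅(H : 𝔤₀), n⁆ = 0 := by
    intro H
    have h1 := key _ hx H
    have h2 := key _ hJ H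
    rw [map_add, conjugation_smul, conjugation_incl, conjugation_incl, Complex.conj_I] at h2
    rw [complexified_lie_add, complexified_lie_smul, ← incl_lie, ← incl_lie] at h1 h2
    constructor <;> apply b.incl_injective
    · have : (2 : ℂ) • incl 𝔤₀ ⁅(H : 𝔤₀), m⁆ = 0 := by
        calc _ = (incl 𝔤₀ ⁅(H : 𝔤₀), m⁆ + Complex.I • incl 𝔤₀ ⁅(H : 𝔤₀), n⁆) +
            (incl 𝔤₀ ⁅(H : 𝔤₀), m⁆ + -Complex.I • incl 𝔤₀ ⁅(H : 𝔤₀), n⁆) := by module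
          _ = 0 := by rw [h1, h2]; simp
      exact (smul_eq_zero.mp this).resolve_left two_ne_zero
    · have : (2 * Complex.I) • incl 𝔤₀ ⁅(H : 𝔤₀), n⁆ = 0 := by
        calc _ = (incl 𝔤₀ ⁅(H : 𝔤₀), m⁆ + Complex.I • incl 𝔤₀ ⁅(H : 𝔤₀), n⁆) -
            (incl 𝔤₀ ⁅(H : 𝔤₀), m⁆ + -Complex.I • incl 𝔤₀ ⁅(H : 𝔤₀), n⁆) := by module
          _ = 0 := by rw [h1, h2]; simp
      exact (smul_eq_zero.mp this).resolve_left (by simp)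
  refine ⟨toComplexify 𝔥₀ ⟨m, mem_of_maximal_of_lie_eq_zero hmax fun H => (hmn H).1⟩ +
    Complex.I • toComplexify 𝔥₀ ⟨n, mem_of_maximal_of_lie_eq_zero hmax fun H => (hmn H).2⟩, rfl⟩

theorem complexForm_lie_coe (b : InvForm 𝔤₀ 𝔤₀) {α : Module.Dual ℂ (complexify 𝔥₀)} {x : ℂ ⊗[ℝ] 𝔤₀}
    (hx : x ∈ wtSpace 𝔥₀ 𝔤₀ α) (y : ℂ ⊗[ℝ] 𝔤₀) (h : complexify 𝔥₀) :
    b.complexForm ⁅x, y⁆ (h : ℂ ⊗[ℝ] 𝔤₀) = α h * b.complexForm x y := by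
  have h1 : ⁅x, (h : ℂ ⊗[ℝ] 𝔤₀)⁆ = -(α h • x) := by
    rw [← complexified_lie_skew]
    exact congrArg Neg.neg (lie_of_mem_wtSpace hx h)
  have h2 : b.complexForm ⁅x, y⁆ (h : ℂ ⊗[ℝ] 𝔤₀) = _ := b.complexForm_lie x y h
  rw [h2, h1, map_neg, neg_neg, map_smul, smul_eq_mul, b.complexForm_symm]

theorem lie_conjugation_mem (b : InvForm 𝔤₀ 𝔤₀) {α : Module.Dual ℂ (complexify 𝔥₀)} {x y : ℂ ⊗[ℝ] 𝔤₀}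
    (hx : x ∈ wtSpace 𝔥₀ 𝔤₀ α) (hy : y ∈ wtSpace 𝔥₀ 𝔤₀ α) :
    ⁅x, conjugation 𝔤₀ y⁆ ∈ wtSpace 𝔥₀ 𝔤₀ 0 := by
  have := lie_mem_wtSpace hx (b.conjugation_mem_wtSpace hy)
  rwa [add_neg_cancel] at this

/-- For a root vector `X` the element `[X, J X]` lies in `𝔥₀^ℂ` and the root is negative on it. -/
theorem exists_coroot (b : InvForm 𝔤₀ 𝔤₀)
    (hmax : Maximal (fun K : LieSubalgebra ℝ 𝔤₀ => IsLieAbelian K) 𝔥₀)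
    {α : Module.Dual ℂ (complexify 𝔥₀)} (hα : α ≠ 0) {x : ℂ ⊗[ℝ] 𝔤₀}
    (hx : x ∈ wtSpace 𝔥₀ 𝔤₀ α) (h0 : x ≠ 0) :
    ∃ h : complexify 𝔥₀, (h : ℂ ⊗[ℝ] 𝔤₀) = ⁅x, conjugation 𝔤₀ x⁆ ∧
      ∃ r : ℝ, 0 < r ∧ α h = -(r : ℂ) := by
  obtain ⟨h, hh⟩ := b.exists_coe_eq_of_mem_wtSpace_zero hmax (b.lie_conjugation_mem hx hx)
  refine ⟨h, hh, ?_⟩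
  obtain ⟨s, hs, hxs⟩ := b.hermitian_pos h0
  have hs' : (s : ℂ) ≠ 0 := by exact_mod_cast hs.ne'
  -- Pairing [x, J x] with H gives α(H)⟨x, J x⟩, which is nonzero for a suitable H.
  have hne : (h : ℂ ⊗[ℝ] 𝔤₀) ≠ 0 := by
    intro hz
    obtain ⟨H, hH⟩ := exists_toComplexify_ne_zero hα
    have := b.complexForm_lie_coe hx (conjugation 𝔤₀ x) (toComplexify 𝔥₀ H)
    rw [← hh, hz, map_zero, LinearMap.zero_apply, hxs] at this
    exact mul_ne_zero hH hs' this.symm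
  -- As J h = -h, the squared norm t of h equals -α(h) s, with s the squared norm of x. Hence α(h) =
  -- -t / s.
  have hJ : conjugation 𝔤₀ (h : ℂ ⊗[ℝ] 𝔤₀) = -(h : ℂ ⊗[ℝ] 𝔤₀) := by
    rw [hh, conjugation_lie, conjugation_conjugation]
    exact (complexified_lie_skew _ _).symm
  obtain ⟨t, ht, hht⟩ := b.hermitian_pos hne
  rw [hJ, map_neg] at hht
  nth_rewrite 1 [hh] at hht
  rw [b.complexForm_lie_coe hx, hxs] at hht
  refine ⟨t / s, div_pos ht hs, ?_⟩
  push_cast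
  field_simp
  linear_combination -hht

/-- Since -J x is the Hermitian adjoint of x, this is the usual commutator identity: the right side
is |x v|² - |(J x) v|². On a weight vector the left side is a multiple of |v|², so signs of weights
on [x, J x] can be read off. -/
theorem complexForm_lie_lie_conjugation (c : InvForm 𝔤₀ M) (x : ℂ ⊗[ℝ] 𝔤₀) (v : ℂ ⊗[ℝ] M) :
    c.complexForm ⁅⁅x, conjugation 𝔤₀ x⁆, v⁆ (conjugation M v) =
      c.complexForm ⁅x, v⁆ (conjugation M ⁅x, v⁆) -
      c.complexForm ⁅conjugation 𝔤₀ x, v⁆ (conjugation M ⁅conjugation 𝔤₀ x, v⁆) := by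
  rw [complexified_lie_lie, map_sub, LinearMap.sub_apply, c.complexForm_lie x,
    c.complexForm_lie (conjugation 𝔤₀ x) ⁅x, v⁆, conjugation_lie, conjugation_lie,
    conjugation_conjugation]
  ring

theorem eq_zero_of_mem_rootSpace_of_orthogonal (b : InvForm 𝔤₀ 𝔤₀)
    (hmax : Maximal (fun K : LieSubalgebra ℝ 𝔤₀ => IsLieAbelian K) 𝔥₀)
    {α : Module.Dual ℂ (complexify 𝔥₀)} (hα : α ≠ 0) {x y : ℂ ⊗[ℝ] 𝔤₀}
    (hx : x ∈ wtSpace 𝔥₀ 𝔤₀ α) (h0 : x ≠ 0) (hy : y ∈ wtSpace 𝔥₀ 𝔤₀ α)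
    (hxy : b.complexForm y (conjugation 𝔤₀ x) = 0) : y = 0 := by
  -- The bracket [y, J x] lies in the complexified Cartan subalgebra, and its pairing with any k
  -- there is α(k)⟨y, J x⟩ = 0. Taking k to be its own conjugate shows that it vanishes.
  have hbr : ⁅conjugation 𝔤₀ x, y⁆ = 0 := by
    have hmem := b.lie_conjugation_mem hy hx
    have hJ := b.conjugation_mem_wtSpace hmem
    rw [neg_zero] at hJ
    obtain ⟨k, hk⟩ := b.exists_coe_eq_of_mem_wtSpace_zero hmax hJ
    have h := b.complexForm_lie_coe hy (conjugation 𝔤₀ x) k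
    rw [hk, hxy, mul_zero] at h
    rw [← complexified_lie_skew, b.eq_zero_of_hermitian_eq_zero h, neg_zero]
  obtain ⟨h, hh, r, hr, hαh⟩ := b.exists_coroot hmax hα hx h0
  by_contra hy0
  obtain ⟨s, hs, hys⟩ := b.hermitian_pos hy0
  obtain ⟨t, ht, hyt⟩ := b.hermitian_nonneg ⁅x, y⁆
  have key := b.complexForm_lie_lie_conjugation x y
  rw [hbr, map_zero, LinearMap.zero_apply, sub_zero, hyt, ← hh] at key
  have h1 : ⁅(h : ℂ ⊗[ℝ] 𝔤₀), y⁆ = α h • y := lie_of_mem_wtSpace hy h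
  rw [h1, map_smul, LinearMap.smul_apply, hys, hαh, smul_eq_mul] at key
  -- The norm identity reads α(h)|y|² = |[x, y]|², negative on the left and nonnegative on the
  -- right.
  have : -r * s = t := by exact_mod_cast key
  nlinarith [mul_pos hr hs]

/-- The root spaces are lines. -/
theorem exists_smul_eq_of_mem_rootSpace (b : InvForm 𝔤₀ 𝔤₀)
    (hmax : Maximal (fun K : LieSubalgebra ℝ 𝔤₀ => IsLieAbelian K) 𝔥₀)
    {α : Module.Dual ℂ (complexify 𝔥₀)} (hα : α ≠ 0) {x y : ℂ ⊗[ℝ] 𝔤₀}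
    (hx : x ∈ wtSpace 𝔥₀ 𝔤₀ α) (h0 : x ≠ 0) (hy : y ∈ wtSpace 𝔥₀ 𝔤₀ α) : ∃ c : ℂ, c • x = y := by
  obtain ⟨r, hr, hxr⟩ := b.hermitian_pos h0
  have hr' : (r : ℂ) ≠ 0 := by exact_mod_cast hr.ne'
  refine ⟨b.complexForm y (conjugation 𝔤₀ x) / r, (sub_eq_zero.mp ?_).symm⟩
  refine b.eq_zero_of_mem_rootSpace_of_orthogonal hmax hα hx h0
    (sub_mem hy (Submodule.smul_mem _ _ hx)) ?_
  rw [map_sub, LinearMap.sub_apply, map_smul, LinearMap.smul_apply, hxr, smul_eq_mul,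
    div_mul_cancel₀ _ hr', sub_self]

/-- A root vector of `-α` acts nontrivially from `M_μ` to `M_{μ-α}` if both are nonzero. -/
theorem exists_lie_ne_zero (b : InvForm 𝔤₀ 𝔤₀) (c : InvForm 𝔤₀ M)
    (hmax : Maximal (fun K : LieSubalgebra ℝ 𝔤₀ => IsLieAbelian K) 𝔥₀)
    {α μ : Module.Dual ℂ (complexify 𝔥₀)} (hα : α ≠ 0) (hμ : wtSpace 𝔥₀ M μ ≠ ⊥)
    (hμα : wtSpace 𝔥₀ M (μ - α) ≠ ⊥) {x : ℂ ⊗[ℝ] 𝔤₀} (hx : x ∈ wtSpace 𝔥₀ 𝔤₀ (-α)) (h0 : x ≠ 0) :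
    ∃ v ∈ wtSpace 𝔥₀ M μ, ⁅x, v⁆ ≠ 0 := by
  by_contra! hkill
  obtain ⟨h, hh, r, hr, hαh⟩ := b.exists_coroot hmax (neg_ne_zero.mpr hα) hx h0
  have hJx := b.conjugation_mem_wtSpace hx
  rw [neg_neg] at hJx
  obtain ⟨v, hv, hv0⟩ := Submodule.exists_mem_ne_zero_of_ne_bot hμ
  obtain ⟨w, hw, hw0⟩ := Submodule.exists_mem_ne_zero_of_ne_bot hμα
  -- If x kills M_μ, then its adjoint kills M_{μ-α}. The norm identity on v gives μ(h) ≤ 0 and on w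
  -- gives (μ - α)(h) ≥ 0, while α(h) = r > 0.
  have hJw : ⁅conjugation 𝔤₀ x, w⁆ = 0 := by
    apply c.eq_zero_of_hermitian_eq_zero
    have hmem := lie_mem_wtSpace hJx hw
    rw [add_sub_cancel] at hmem
    rw [c.complexForm_lie, ← conjugation_lie, hkill _ hmem, map_zero, map_zero, neg_zero]
  obtain ⟨p, hp, hvp⟩ := c.hermitian_pos hv0
  obtain ⟨q, hq, hwq⟩ := c.hermitian_pos hw0
  obtain ⟨s, hs, hvs⟩ := c.hermitian_nonneg ⁅conjugation 𝔤₀ x, v⁆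
  obtain ⟨t, ht, hwt⟩ := c.hermitian_nonneg ⁅x, w⁆
  have hv1 := c.complexForm_lie_lie_conjugation x v
  have hw1 := c.complexForm_lie_lie_conjugation x w
  rw [hkill v hv, map_zero, LinearMap.zero_apply, zero_sub, hvs, ← hh, lie_of_mem_wtSpace hv,
    map_smul, LinearMap.smul_apply, hvp, smul_eq_mul] at hv1
  rw [hJw, map_zero, LinearMap.zero_apply, sub_zero, hwt, ← hh, lie_of_mem_wtSpace hw,
    map_smul, LinearMap.smul_apply, hwq, smul_eq_mul, LinearMap.sub_apply] at hw1
  rw [LinearMap.neg_apply, neg_inj] at hαh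
  have hp' : (p : ℂ) ≠ 0 := by exact_mod_cast hp.ne'
  rw [hαh, show μ h = ((-s / p : ℝ) : ℂ) by push_cast; field_simp; exact hv1] at hw1
  have hfin : (-s / p - r) * q = t := by exact_mod_cast hw1
  have : -s / p ≤ 0 := div_nonpos_of_nonpos_of_nonneg (by linarith) hp.le
  nlinarith [mul_pos hr hq]

end InvForm

end Roots

/-! ### Real weight spaces -/

section RealWeights

variable {𝔤₀ M : Type*} [LieRing 𝔤₀] [LieAlgebra ℝ 𝔤₀]
  [AddCommGroup M] [Module ℝ M] [LieRingModule 𝔤₀ M] [LieModule ℝ 𝔤₀ M]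
  {𝔥₀ : LieSubalgebra ℝ 𝔤₀}

theorem complexified_lie_sum {ι : Type*} (s : Finset ι) (f : ι → ℂ ⊗[ℝ] 𝔤₀) (m : ℂ ⊗[ℝ] M) :
    ⁅∑ i ∈ s, f i, m⁆ = ∑ i ∈ s, ⁅f i, m⁆ := by
  classical
  induction s using Finset.induction_on with
  | empty => simp only [Finset.sum_empty, complexified_zero_lie]
  | insert i s hi ih => rw [Finset.sum_insert hi, Finset.sum_insert hi, add_lie, ih]

theorem neg_ne_self_of_ne_zero {μ : Module.Dual ℂ (complexify 𝔥₀)} (hμ : μ ≠ 0) : μ ≠ -μ := by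
  intro h
  have : (2 : ℂ) • μ = 0 := by rw [two_smul]; nth_rewrite 2 [h]; exact add_neg_cancel μ
  exact hμ ((smul_eq_zero.mp this).resolve_left two_ne_zero)

theorem eq_of_add_eq_of_mem_wtSpace {μ : Module.Dual ℂ (complexify 𝔥₀)}
    (hμ : μ ≠ 0) {v v' w w' : ℂ ⊗[ℝ] M} (hv : v ∈ wtSpace 𝔥₀ M μ) (hv' : v' ∈ wtSpace 𝔥₀ M μ)
    (hw : w ∈ wtSpace 𝔥₀ M (-μ)) (hw' : w' ∈ wtSpace 𝔥₀ M (-μ)) (h : v + w = v' + w') :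
    v = v' := by
  have h1 : v - v' = w' - w := by rw [sub_eq_sub_iff_add_eq_add, h, add_comm]
  exact sub_eq_zero.mp (eq_zero_of_mem_wtSpace (neg_ne_self_of_ne_zero hμ) (sub_mem hv hv')
    (h1 ▸ sub_mem hw' hw))

namespace InvForm

/-- A real vector v + w with parts of weights μ and -μ is fixed by `J`, which swaps the two spaces;
as μ ≠ -μ, comparing parts gives w = J v. -/
theorem exists_of_mem_realWtSpace (c : InvForm 𝔤₀ M) {μ : Module.Dual ℂ (complexify 𝔥₀)}
    (hμ : μ ≠ 0) {m : M} (hm : m ∈ realWtSpace 𝔥₀ M μ) :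
    ∃ v ∈ wtSpace 𝔥₀ M μ, incl M m = v + conjugation M v := by
  obtain ⟨v, hv, w, hw, h⟩ := Submodule.mem_sup.mp (show incl M m ∈ _ ⊔ _ from hm)
  refine ⟨v, hv, ?_⟩
  have hJw := c.conjugation_mem_wtSpace hw
  rw [neg_neg] at hJw
  have hJ : v + w = conjugation M w + conjugation M v := by
    rw [add_comm (conjugation M w), ← map_add, h, conjugation_incl]
  have h1 := eq_of_add_eq_of_mem_wtSpace hμ hv hJw hw (c.conjugation_mem_wtSpace hv) hJ
  rw [← h, add_right_inj, h1, conjugation_conjugation]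

theorem exists_mem_realWtSpace (c : InvForm 𝔤₀ M) {μ : Module.Dual ℂ (complexify 𝔥₀)}
    {v : ℂ ⊗[ℝ] M} (hv : v ∈ wtSpace 𝔥₀ M μ) :
    ∃ m ∈ realWtSpace 𝔥₀ M μ, incl M m = v + conjugation M v := by
  obtain ⟨m, hm⟩ := exists_incl_eq_of_conjugation_eq (x := v + conjugation M v)
    (by rw [map_add, conjugation_conjugation, add_comm])
  refine ⟨m, ?_, hm⟩
  change incl M m ∈ wtSpace 𝔥₀ M μ ⊔ wtSpace 𝔥₀ M (-μ)
  rw [hm]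
  exact Submodule.add_mem_sup hv (c.conjugation_mem_wtSpace hv)

theorem realWtSpace_eq_bot (c : InvForm 𝔤₀ M) {μ : Module.Dual ℂ (complexify 𝔥₀)}
    (h : wtSpace 𝔥₀ M μ = ⊥) : realWtSpace 𝔥₀ M μ = ⊥ := by
  rw [Submodule.eq_bot_iff]
  intro m hm
  apply c.incl_injective
  change incl M m ∈ wtSpace 𝔥₀ M μ ⊔ wtSpace 𝔥₀ M (-μ) at hm
  rwa [h, c.wtSpace_neg_eq_bot_iff.mpr h, sup_bot_eq, Submodule.mem_bot] at hm

theorem complexForm_incl_conjugation (c : InvForm 𝔤₀ M) (m : M) (x : ℂ ⊗[ℝ] M) :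
    c.complexForm (incl M m) (conjugation M x) = starRingEnd ℂ (c.complexForm (incl M m) x) := by
  rw [← complexForm_conjugation, conjugation_incl]

theorem complexForm_sum (c : InvForm 𝔤₀ M)
    (f : Module.Dual ℂ (complexify 𝔥₀) →₀ ℂ ⊗[ℝ] M) (hf : ∀ μ, f μ ∈ wtSpace 𝔥₀ M μ)
    {ν : Module.Dual ℂ (complexify 𝔥₀)} {y : ℂ ⊗[ℝ] M} (hy : y ∈ wtSpace 𝔥₀ M (-ν)) :
    c.complexForm (∑ μ ∈ f.support, f μ) y = c.complexForm (f ν) y := by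
  rw [map_sum, LinearMap.sum_apply]
  refine Finset.sum_eq_single ν (fun μ _ hne => ?_) (fun h => ?_)
  · refine c.complexForm_eq_zero ?_ (hf μ) hy
    rwa [← sub_eq_add_neg, sub_ne_zero]
  · rw [Finsupp.notMem_support_iff.mp h]; simp

/-- Pairing with a vector of weight -(β + μ) isolates the component of weight β + μ, so no separate
appeal to independence of weight spaces is needed. -/
theorem complexForm_sum_lie (c : InvForm 𝔤₀ M)
    (f : Module.Dual ℂ (complexify 𝔥₀) →₀ ℂ ⊗[ℝ] 𝔤₀) (hf : ∀ β, f β ∈ wtSpace 𝔥₀ 𝔤₀ β)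
    {β μ : Module.Dual ℂ (complexify 𝔥₀)} {v y : ℂ ⊗[ℝ] M} (hv : v ∈ wtSpace 𝔥₀ M μ)
    (hy : y ∈ wtSpace 𝔥₀ M (-(β + μ))) :
    c.complexForm ⁅∑ γ ∈ f.support, f γ, v⁆ y = c.complexForm ⁅f β, v⁆ y := by
  rw [complexified_lie_sum, map_sum, LinearMap.sum_apply]
  refine Finset.sum_eq_single β (fun γ _ hne => ?_) (fun h => ?_)
  · refine c.complexForm_eq_zero ?_ (lie_mem_wtSpace (hf γ) hv) hy
    intro h0
    exact hne (sub_eq_zero.mp (by rw [← h0]; abel))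
  · rw [Finsupp.notMem_support_iff.mp h, complexified_zero_lie]; simp

/-- Both x + J x and i x + J(i x) come from real vectors. Orthogonality to them kills the real and
the imaginary part of the pairing of Z with x. -/
theorem complexForm_eq_zero_of_orthogonal_realWtSpace (b : InvForm 𝔤₀ M)
    {α : Module.Dual ℂ (complexify 𝔥₀)} {Z : M}
    (hZ : ∀ Y ∈ realWtSpace 𝔥₀ M α, b.form Z Y = 0) {x : ℂ ⊗[ℝ] M} (hx : x ∈ wtSpace 𝔥₀ M α) :
    b.complexForm (incl M Z) x = 0 := by
  obtain ⟨m, hm, h⟩ := b.exists_mem_realWtSpace hx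
  obtain ⟨n, hn, h'⟩ := b.exists_mem_realWtSpace (Submodule.smul_mem _ Complex.I hx)
  have h1 := b.complexForm_incl Z m
  have h2 := b.complexForm_incl Z n
  rw [h, hZ m hm, map_add, Complex.ofReal_zero] at h1
  rw [h', hZ n hn, map_add, Complex.ofReal_zero, conjugation_smul, map_smul, map_smul,
    Complex.conj_I, smul_eq_mul, smul_eq_mul] at h2
  linear_combination (1 / 2) * h1 - (Complex.I / 2) * h2 +
    (1 / 2) * (b.complexForm (incl M Z) x - b.complexForm (incl M Z) (conjugation M x)) *
      Complex.I_mul_I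

theorem form_eq_zero_of_mem_realWtSpace (b : InvForm 𝔤₀ M)
    {α : Module.Dual ℂ (complexify 𝔥₀)} (hα : α ≠ 0) {Z Y : M}
    (hZ : ∀ x ∈ wtSpace 𝔥₀ M α, b.complexForm (incl M Z) x = 0) (hY : Y ∈ realWtSpace 𝔥₀ M α) :
    b.form Z Y = 0 := by
  obtain ⟨x, hx, h⟩ := b.exists_of_mem_realWtSpace hα hY
  have h1 := b.complexForm_incl Z Y
  rw [h, map_add, complexForm_incl_conjugation, hZ x hx, map_zero, add_zero] at h1
  exact_mod_cast h1.symm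

end InvForm

end RealWeights

/-! ### The real weight vector -/

namespace InvariantInnerProduct

variable {𝔤₀ U : Type*} [LieRing 𝔤₀] [LieAlgebra ℝ 𝔤₀]
  [AddCommGroup U] [Module ℝ U] [LieRingModule 𝔤₀ U] [LieModule ℝ 𝔤₀ U]
  {𝔥₀ : LieSubalgebra ℝ 𝔤₀}

/-- The restriction of the inner product to the module. -/
def onModule (B : InvariantInnerProduct 𝔤₀ U) : InvForm 𝔤₀ U where
  form := B.form.compl₁₂ (LinearMap.inl ℝ U 𝔤₀) (LinearMap.inl ℝ U 𝔤₀)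
  symm _ _ := B.symm _ _
  pos u hu := B.pos (u, 0) (by simpa [Prod.ext_iff] using hu)
  skew X u v := B.skew_module X u v

/-- The restriction of the inner product to the Lie algebra. -/
def onAlgebra (B : InvariantInnerProduct 𝔤₀ U) : InvForm 𝔤₀ 𝔤₀ where
  form := B.formAlg
  symm _ _ := B.symm _ _
  pos X hX := B.pos (0, X) (by simpa [Prod.ext_iff] using hX)
  skew X Y Z := B.skew_adjoint X Y Z

theorem complexForm_realWeightVector (B : InvariantInnerProduct 𝔤₀ U)
    {μ : Module.Dual ℂ (complexify 𝔥₀)} {H : 𝔤₀} (hH : B.IsRealWeightVector 𝔥₀ μ H)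
    (h : complexify 𝔥₀) :
    B.onAlgebra.complexForm (h : ℂ ⊗[ℝ] 𝔤₀) (incl 𝔤₀ H) = -Complex.I * μ h := by
  have key : ∀ a : 𝔥₀, B.onAlgebra.complexForm (incl 𝔤₀ (a : 𝔤₀)) (incl 𝔤₀ H) =
      -Complex.I * μ (toComplexify 𝔥₀ a) := fun a => by
    rw [InvForm.complexForm_incl]; exact hH.2 a
  obtain ⟨a, c, rfl⟩ := exists_eq_toComplexify_add h
  change B.onAlgebra.complexForm (incl 𝔤₀ (a : 𝔤₀) + Complex.I • incl 𝔤₀ (c : 𝔤₀)) _ = _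
  rw [map_add, map_smul, map_add, map_smul, LinearMap.add_apply, LinearMap.smul_apply, key, key,
    smul_eq_mul, smul_eq_mul]
  ring

theorem existsUnique_realWeightVector [FiniteDimensional ℝ 𝔤₀] (B : InvariantInnerProduct 𝔤₀ U)
    {μ : Module.Dual ℂ (complexify 𝔥₀)} (hμ : wtSpace 𝔥₀ U μ ≠ ⊥) :
    ∃! H : 𝔤₀, B.IsRealWeightVector 𝔥₀ μ H := by
  obtain ⟨v, hv, hv0⟩ := Submodule.exists_mem_ne_zero_of_ne_bot hμ
  let toC : 𝔥₀ →ₗ[ℝ] complexify 𝔥₀ :=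
    { toFun := toComplexify 𝔥₀
      map_add' := fun a c => Subtype.ext (map_add (incl 𝔤₀) (a : 𝔤₀) c)
      map_smul' := fun r a => Subtype.ext (map_smul (incl 𝔤₀) r (a : 𝔤₀)) }
  -- Weights are imaginary on `𝔥₀`, so -i μ is the real functional Im μ there; the weight vector is
  -- its Riesz representative.
  let l : Module.Dual ℝ 𝔥₀ := Complex.imLm ∘ₗ μ.restrictScalars ℝ ∘ₗ toC
  have hl : ∀ a : 𝔥₀, ((l a : ℝ) : ℂ) = -Complex.I * μ (toComplexify 𝔥₀ a) := by
    intro a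
    have him := B.onModule.weight_imaginary hv hv0 a
    have hre : (μ (toComplexify 𝔥₀ a)).re = 0 := by
      have := congrArg Complex.re him
      simp only [Complex.conj_re, Complex.neg_re] at this
      linarith
    change (((μ (toComplexify 𝔥₀ a)).im : ℝ) : ℂ) = _
    apply Complex.ext <;> simp [hre]
  let c : LinearMap.BilinForm ℝ 𝔥₀ :=
    B.formAlg.compl₁₂ 𝔥₀.toSubmodule.subtype 𝔥₀.toSubmodule.subtype
  have hc : c.Nondegenerate := by
    have key : ∀ X, c X X = 0 → X = 0 := fun X hX => by
      by_contra hne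
      exact (B.onAlgebra.pos (X : 𝔤₀) (fun h => hne (Subtype.ext h))).ne' hX
    exact ⟨fun X h => key X (h X), fun X h => key X (h X)⟩
  have : FiniteDimensional ℝ 𝔥₀ := inferInstanceAs (FiniteDimensional ℝ 𝔥₀.toSubmodule)
  refine ⟨((c.toDual hc).symm l : 𝔥₀), ⟨((c.toDual hc).symm l).2, fun a => ?_⟩, ?_⟩
  · rw [← hl, ← LinearMap.BilinForm.apply_toDual_symm_apply (hB := hc) l a, B.symm]
    rfl
  · rintro H ⟨hH, hH'⟩
    have : (⟨H, hH⟩ : 𝔥₀) = (c.toDual hc).symm l := by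
      rw [LinearEquiv.eq_symm_apply]
      ext a
      have h1 := hH' a
      rw [← hl, B.symm] at h1
      exact_mod_cast h1
    rw [← this]

/-- Some root moves the weight `μ` to another weight. -/
theorem rootsAt_nonempty [FiniteDimensional ℝ 𝔤₀]
    (hcompact : ∀ X : 𝔤₀, X ≠ 0 → killingForm ℝ 𝔤₀ X X < 0) (B : InvariantInnerProduct 𝔤₀ U)
    (hmax : Maximal (fun K : LieSubalgebra ℝ 𝔤₀ => IsLieAbelian K) 𝔥₀)
    {μ : Module.Dual ℂ (complexify 𝔥₀)} (hμ : μ ∈ weights 𝔥₀ U) :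
    (rootsAt 𝔥₀ U μ).Nonempty := by
  by_contra! hempty
  have := hmax.prop
  obtain ⟨v, hv, hv0⟩ := Submodule.exists_mem_ne_zero_of_ne_bot hμ.2
  obtain ⟨H, hH, -⟩ := B.existsUnique_realWeightVector hμ.2
  let H₁ : 𝔥₀ := ⟨H, hH.1⟩
  have hkill : ∀ α ∈ roots 𝔥₀, ∀ x ∈ wtSpace 𝔥₀ 𝔤₀ α, ⁅x, v⁆ = 0 := by
    intro α hα x hx
    have hbot : wtSpace 𝔥₀ U (μ - -α) = ⊥ := by
      by_contra hne
      exact Set.notMem_empty (-α) (hempty ▸ ⟨B.onAlgebra.neg_mem_roots hα, hne⟩)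
    have hmem := lie_mem_wtSpace hx hv
    rwa [add_comm, ← sub_neg_eq_add, hbot, Submodule.mem_bot] at hmem
  -- All root vectors kill v, so μ vanishes on [x, J x]. But -i μ([x, J x]) = ⟨[x, J x], H⟩ =
  -- α(H)|x|², so every root vanishes on H. Thus H is central, hence zero by definiteness of the
  -- Killing form, which contradicts μ ≠ 0.
  have hcentral : ∀ α, ∀ x ∈ wtSpace 𝔥₀ 𝔤₀ α, ⁅incl 𝔤₀ H, x⁆ = 0 := by
    intro α x hx
    rw [show ⁅incl 𝔤₀ H, x⁆ = _ from mem_wtSpace_iff.mp hx H₁]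
    by_cases hα : α = 0
    · simp [hα]
    by_cases hx0 : x = 0
    · simp [hx0]
    have hroot : α ∈ roots 𝔥₀ := ⟨hα, fun h => hx0 (by rwa [h, Submodule.mem_bot] at hx)⟩
    obtain ⟨k, hk, -⟩ := B.onAlgebra.exists_coroot hmax hα hx hx0
    obtain ⟨r, hr, hxr⟩ := B.onAlgebra.hermitian_pos hx0
    have h1 := lie_of_mem_wtSpace hv k
    rw [hk, complexified_lie_lie, hkill α hroot x hx,
      hkill (-α) (B.onAlgebra.neg_mem_roots hroot) _ (B.onAlgebra.conjugation_mem_wtSpace hx),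
      complexified_lie_zero, complexified_lie_zero, sub_zero] at h1
    have h2 : μ k = 0 := (smul_eq_zero.mp h1.symm).resolve_right hv0
    have h3 := B.onAlgebra.complexForm_lie_coe hx (conjugation 𝔤₀ x) (toComplexify 𝔥₀ H₁)
    rw [← hk, show ((toComplexify 𝔥₀ H₁ : complexify 𝔥₀) : ℂ ⊗[ℝ] 𝔤₀) = incl 𝔤₀ H from rfl,
      B.complexForm_realWeightVector hH, h2, mul_zero, hxr] at h3
    rw [(mul_eq_zero.mp h3.symm).resolve_right (by exact_mod_cast hr.ne'), zero_smul]
  have had : LieAlgebra.ad ℝ 𝔤₀ H = 0 := by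
    ext X
    apply B.onAlgebra.incl_injective
    rw [LieAlgebra.ad_apply, incl_lie]
    have hX : incl 𝔤₀ X ∈ ⨆ α, wtSpace 𝔥₀ 𝔤₀ α := by rw [B.onAlgebra.iSup_wtSpace]; trivial
    generalize incl 𝔤₀ X = x at hX ⊢
    induction hX using Submodule.iSup_induction' with
    | mem α x hx => exact hcentral α x hx
    | zero => exact complexified_lie_zero _
    | add x y _ _ hx hy => rw [complexified_lie_add, hx, hy, add_zero]
  have hH0 : H = 0 := by
    by_contra hne
    have := hcompact H hne
    rw [killingForm_apply_apply, had] at this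
    simp at this
  apply hμ.1
  ext k
  have := B.complexForm_realWeightVector hH k
  rw [hH0, map_zero, map_zero] at this
  simpa using this.symm

end InvariantInnerProduct

/-! ### Zariski closed sets -/

section Zariski

variable {W : Type*} [AddCommGroup W] [Module ℝ W]

theorem isZariskiClosed_empty : IsZariskiClosed (∅ : Set W) :=
  ⟨{1}, by simp, by ext; simp⟩

/-- A subspace is the common zero set of the linear functionals in its annihilator. -/
theorem isZariskiClosed_submodule (S : Submodule ℝ W) : IsZariskiClosed (S : Set W) := by
  refine ⟨{p | ∃ l ∈ S.dualAnnihilator, p = l}, ?_, ?_⟩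
  · rintro _ ⟨l, -, rfl⟩
    exact Algebra.subset_adjoin ⟨l, rfl⟩
  · ext w
    rw [SetLike.mem_coe, ← Subspace.dualAnnihilator_dualCoannihilator_eq (W := S),
      Submodule.mem_dualCoannihilator]
    constructor
    · rintro h _ ⟨l, hl, rfl⟩
      rw [Subspace.dualAnnihilator_dualCoannihilator_eq] at hl
      exact h l hl
    · intro h l hl
      exact h l ⟨l, by rwa [Subspace.dualAnnihilator_dualCoannihilator_eq], rfl⟩

theorem IsZariskiClosed.union {S T : Set W} (hS : IsZariskiClosed S) (hT : IsZariskiClosed T) :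
    IsZariskiClosed (S ∪ T) := by
  obtain ⟨P, hP, rfl⟩ := hS
  obtain ⟨Q, hQ, rfl⟩ := hT
  refine ⟨{f | ∃ p ∈ P, ∃ q ∈ Q, f = p * q}, ?_, ?_⟩
  · rintro _ ⟨p, hp, q, hq, rfl⟩
    exact mul_mem (hP hp) (hQ hq)
  · ext w
    constructor
    · rintro (h | h) _ ⟨p, hp, q, hq, rfl⟩
      · simp [h p hp]
      · simp [h q hq]
    · intro h
      by_contra hn
      simp only [Set.mem_union, Set.mem_ofPred_eq, not_or, not_forall] at hn
      obtain ⟨⟨p, hp, hpw⟩, ⟨q, hq, hqw⟩⟩ := hn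
      exact mul_ne_zero hpw hqw (h _ ⟨p, hp, q, hq, rfl⟩)

theorem isZariskiClosed_biUnion {ι : Type*} {s : Set ι} (hs : s.Finite) {S : ι → Set W}
    (hS : ∀ i ∈ s, IsZariskiClosed (S i)) : IsZariskiClosed (⋃ i ∈ s, S i) := by
  induction s, hs using Set.Finite.induction_on with
  | empty => simpa using isZariskiClosed_empty
  | insert _ _ ih =>
    rw [Set.biUnion_insert]
    exact (hS _ (Set.mem_insert _ _)).union (ih fun i hi => hS i (Set.mem_insert_of_mem _ hi))

end Zariski

/-! ### The exceptional set -/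

section Exceptional

variable {𝔤₀ M : Type*} [LieRing 𝔤₀] [LieAlgebra ℝ 𝔤₀]
  [AddCommGroup M] [Module ℝ M] [LieRingModule 𝔤₀ M] [LieModule ℝ 𝔤₀ M]
  {𝔥₀ : LieSubalgebra ℝ 𝔤₀}

/-- The image of `rootKer` in the real weight space under `v ↦ v + J v`. -/
def realRootKer (𝔥₀ : LieSubalgebra ℝ 𝔤₀) (M : Type*) [AddCommGroup M] [Module ℝ M]
    [LieRingModule 𝔤₀ M] [LieModule ℝ 𝔤₀ M] (μ α : Module.Dual ℂ (complexify 𝔥₀)) :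
    Submodule ℝ (realWtSpace 𝔥₀ M μ) where
  carrier := {u | ∃ v ∈ rootKer 𝔥₀ M μ α, incl M (u : M) = v + conjugation M v}
  add_mem' := by
    rintro u u' ⟨v, ⟨hv, hk⟩, h⟩ ⟨v', ⟨hv', hk'⟩, h'⟩
    refine ⟨v + v', ⟨add_mem hv hv', fun X hX => ?_⟩, ?_⟩
    · rw [complexified_lie_add, hk X hX, hk' X hX, add_zero]
    · rw [Submodule.coe_add, map_add, h, h', map_add]; abel
  zero_mem' := ⟨0, ⟨zero_mem _, fun X _ => complexified_lie_zero X⟩, by simp⟩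
  smul_mem' := by
    rintro r u ⟨v, ⟨hv, hk⟩, h⟩
    refine ⟨(r : ℂ) • v, ⟨Submodule.smul_mem _ _ hv, fun X hX => ?_⟩, ?_⟩
    · rw [complexified_lie_smul, hk X hX, smul_zero]
    · rw [Submodule.coe_smul, incl_smul, h, conjugation_smul, Complex.conj_ofReal, smul_add]

theorem realExceptional_eq_biUnion {μ : Module.Dual ℂ (complexify 𝔥₀)} (hμ : μ ∉ roots 𝔥₀) :
    realExceptional 𝔥₀ M μ =
      ⋃ α ∈ rootsAt 𝔥₀ M μ, (realRootKer 𝔥₀ M μ α : Set (realWtSpace 𝔥₀ M μ)) := by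
  ext u
  simp only [Set.mem_iUnion]
  constructor
  · rintro ⟨v, hv | hv, h⟩
    · exact absurd hv.1 hμ
    · simp only [Set.mem_iUnion] at hv
      obtain ⟨α, hα, hv⟩ := hv
      exact ⟨α, hα, v, hv, h⟩
  · rintro ⟨α, hα, v, hv, h⟩
    exact ⟨v, Or.inr (Set.mem_biUnion hα hv), h⟩

theorem isZariskiClosed_realExceptional [FiniteDimensional ℝ 𝔤₀] [IsLieAbelian 𝔥₀]
    {μ : Module.Dual ℂ (complexify 𝔥₀)} (hμ : μ ∉ roots 𝔥₀) :
    IsZariskiClosed (realExceptional 𝔥₀ M μ) := by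
  rw [realExceptional_eq_biUnion hμ]
  exact isZariskiClosed_biUnion ((finite_weights 𝔤₀).subset fun α hα => hα.1)
    fun α _ => isZariskiClosed_submodule _

theorem InvForm.realExceptional_ne_univ [FiniteDimensional ℝ 𝔤₀] (b : InvForm 𝔤₀ 𝔤₀)
    (c : InvForm 𝔤₀ M) (hmax : Maximal (fun K : LieSubalgebra ℝ 𝔤₀ => IsLieAbelian K) 𝔥₀)
    {μ : Module.Dual ℂ (complexify 𝔥₀)} (hμ : μ ∈ weights 𝔥₀ M) (hroot : μ ∉ roots 𝔥₀) :
    realExceptional 𝔥₀ M μ ≠ Set.univ := by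
  have := hmax.prop
  have hfin : (rootsAt 𝔥₀ M μ).Finite := (finite_weights 𝔤₀).subset fun α hα => hα.1
  classical
  have h := Subspace.biUnion_ne_univ_of_top_notMem
    (s := hfin.toFinset.image (realRootKer 𝔥₀ M μ)) ?_
  · rw [realExceptional_eq_biUnion hroot]
    simpa using h
  · simp only [Finset.mem_image, Set.Finite.mem_toFinset, not_exists, not_and]
    intro α hα htop
    obtain ⟨x, hx, hx0⟩ := Submodule.exists_mem_ne_zero_of_ne_bot (b.neg_mem_roots hα.1).2
    obtain ⟨v, hv, hxv⟩ := b.exists_lie_ne_zero c hmax hα.1.1 hμ.2 hα.2 hx hx0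
    obtain ⟨m, hm, hmv⟩ := c.exists_mem_realWtSpace hv
    obtain ⟨v', ⟨hv', hk⟩, h'⟩ : (⟨m, hm⟩ : realWtSpace 𝔥₀ M μ) ∈ realRootKer 𝔥₀ M μ α := by
      rw [htop]; trivial
    -- The part of weight μ is determined by v + J v, so the witness v' of membership is v itself,
    -- on which x acts nontrivially.
    have := eq_of_add_eq_of_mem_wtSpace hμ.1 hv hv' (c.conjugation_mem_wtSpace hv)
      (c.conjugation_mem_wtSpace hv') (hmv.symm.trans h')
    exact hxv (this ▸ hk x hx)

end Exceptional

/-! ### The range of `ad u` -/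

namespace InvariantInnerProduct

variable {𝔤₀ U : Type*} [LieRing 𝔤₀] [LieAlgebra ℝ 𝔤₀]
  [AddCommGroup U] [Module ℝ U] [LieRingModule 𝔤₀ U] [LieModule ℝ 𝔤₀ U]
  {𝔥₀ : LieSubalgebra ℝ 𝔤₀}

theorem map_ad_range [FiniteDimensional ℝ 𝔤₀] (B : InvariantInnerProduct 𝔤₀ U) (u : U) :
    (LinearMap.range B.inU).map (LieAlgebra.ad ℝ B.Nil (B.inU u)) =
      (LinearMap.range (B.bracketU u)).map B.inG := by
  rw [← LinearMap.range_comp, ← LinearMap.range_comp]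
  rfl

theorem mem_orthogonal_range_bracketU [FiniteDimensional ℝ 𝔤₀] (B : InvariantInnerProduct 𝔤₀ U)
    {u : U} {Z : 𝔤₀} :
    Z ∈ B.formAlg.orthogonal (LinearMap.range (B.bracketU u)) ↔ ⁅Z, u⁆ = 0 := by
  constructor
  · intro h
    by_contra hne
    -- Testing against u' = Z u gives |Z u|² = 0.
    have h1 : B.form (0, B.bracketU u ⁅Z, u⁆) (0, Z) = 0 := h _ ⟨_, rfl⟩
    rw [B.form_bracketU] at h1
    exact (B.onModule.pos _ hne).ne' h1
  · rintro h _ ⟨u', rfl⟩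
    change B.form (0, B.bracketU u u') (0, Z) = 0
    rw [B.form_bracketU, h]
    exact LinearMap.map_zero₂ B.form _

/-- An element orthogonal to the weight vector and to the real root spaces at `μ` annihilates the
real weight space of `μ`. -/
theorem lie_eq_zero_of_orthogonal [FiniteDimensional ℝ 𝔤₀] (B : InvariantInnerProduct 𝔤₀ U)
    (hmax : Maximal (fun K : LieSubalgebra ℝ 𝔤₀ => IsLieAbelian K) 𝔥₀)
    {μ : Module.Dual ℂ (complexify 𝔥₀)} (hμ : μ ≠ 0)
    {H : 𝔤₀} (hH : B.IsRealWeightVector 𝔥₀ μ H) {u : U} (hu : u ∈ realWtSpace 𝔥₀ U μ)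
    {Z : 𝔤₀} (hZH : B.formAlg Z H = 0)
    (hZ : ∀ α ∈ rootsAt 𝔥₀ U μ, ∀ Y ∈ realWtSpace 𝔥₀ 𝔤₀ α, B.formAlg Z Y = 0) : ⁅Z, u⁆ = 0 := by
  have := hmax.prop
  obtain ⟨v, hv, huv⟩ := B.onModule.exists_of_mem_realWtSpace hμ hu
  have hJv := B.onModule.conjugation_mem_wtSpace hv
  obtain ⟨f, hf, hfZ⟩ := B.onAlgebra.exists_weight_decomposition (𝔥₀ := 𝔥₀) (incl 𝔤₀ Z)
  have hpair : ∀ (β) (y), y ∈ wtSpace 𝔥₀ 𝔤₀ (-β) →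
      B.onAlgebra.complexForm (incl 𝔤₀ Z) y = B.onAlgebra.complexForm (f β) y := by
    intro β y hy
    rw [hfZ, B.onAlgebra.complexForm_sum f hf hy]
  have hcomp : ∀ β, ⁅f β, v⁆ = 0 ∧ ⁅f β, conjugation U v⁆ = 0 := by
    intro β
    by_cases hfβ : f β = 0
    · rw [hfβ]; exact ⟨complexified_zero_lie v, complexified_zero_lie _⟩
    by_cases hβ : β = 0
    · subst hβ
      obtain ⟨h, hh⟩ := B.onAlgebra.exists_coe_eq_of_mem_wtSpace_zero hmax (hf 0)
      have h1 := hpair 0 (incl 𝔤₀ H) (by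
        rw [neg_zero]; exact coe_mem_wtSpace_zero (toComplexify 𝔥₀ ⟨H, hH.1⟩))
      rw [InvForm.complexForm_incl, show B.onAlgebra.form Z H = 0 from hZH, ← hh,
        B.complexForm_realWeightVector hH] at h1
      have h2 : μ h = 0 := by simpa using h1.symm
      rw [← hh, lie_of_mem_wtSpace hv, lie_of_mem_wtSpace hJv, LinearMap.neg_apply, h2]
      simp
    have hroot : β ∈ roots 𝔥₀ := ⟨hβ, fun h0 => hfβ (by
      have := hf β; rwa [h0, Submodule.mem_bot] at this)⟩
    have hJf := B.onAlgebra.conjugation_mem_wtSpace (hf β)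
    -- Otherwise β is in Φ_μ, and orthogonality of Z to the real root space gives |f β|² = ⟨Z, J (f
    -- β)⟩ = 0. The same argument with -β treats μ + β.
    have h1 : wtSpace 𝔥₀ U (μ - β) = ⊥ := by
      by_contra hne
      apply hfβ
      apply B.onAlgebra.eq_zero_of_hermitian_eq_zero
      rw [← hpair β _ hJf, InvForm.complexForm_incl_conjugation,
        B.onAlgebra.complexForm_eq_zero_of_orthogonal_realWtSpace (hZ β ⟨hroot, hne⟩) (hf β),
        map_zero]
    have h2 : wtSpace 𝔥₀ U (μ - -β) = ⊥ := by
      by_contra hne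
      apply hfβ
      apply B.onAlgebra.eq_zero_of_hermitian_eq_zero
      rw [← hpair β _ hJf]
      exact B.onAlgebra.complexForm_eq_zero_of_orthogonal_realWtSpace
        (hZ (-β) ⟨B.onAlgebra.neg_mem_roots hroot, hne⟩) hJf
    constructor
    · have := lie_mem_wtSpace (hf β) hv
      rwa [add_comm, ← sub_neg_eq_add, h2, Submodule.mem_bot] at this
    · have := lie_mem_wtSpace (hf β) hJv
      rwa [← sub_eq_add_neg, ← neg_sub, B.onModule.wtSpace_neg_eq_bot_iff.mpr h1,
        Submodule.mem_bot] at this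
  apply B.onModule.incl_injective
  rw [incl_lie, huv, complexified_lie_add, hfZ, complexified_lie_sum, complexified_lie_sum,
    Finset.sum_eq_zero fun β _ => (hcomp β).1, Finset.sum_eq_zero fun β _ => (hcomp β).2, add_zero]

/-- An element annihilating a vector outside the exceptional set is orthogonal to the weight vector
and to the real root spaces at `μ`. -/
theorem orthogonal_of_lie_eq_zero [FiniteDimensional ℝ 𝔤₀]
    (hcompact : ∀ X : 𝔤₀, X ≠ 0 → killingForm ℝ 𝔤₀ X X < 0) (B : InvariantInnerProduct 𝔤₀ U)
    (hmax : Maximal (fun K : LieSubalgebra ℝ 𝔤₀ => IsLieAbelian K) 𝔥₀)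
    {μ : Module.Dual ℂ (complexify 𝔥₀)} (hμ : μ ∈ weights 𝔥₀ U) (hroot : (2 : ℂ) • μ ∉ roots 𝔥₀)
    (hsum : ∀ α ∈ roots 𝔥₀, ∀ β ∈ roots 𝔥₀, (2 : ℂ) • μ ≠ α + β)
    {H : 𝔤₀} (hH : B.IsRealWeightVector 𝔥₀ μ H) {u : realWtSpace 𝔥₀ U μ}
    (hu : u ∉ realExceptional 𝔥₀ U μ) {Z : 𝔤₀} (hZ : ⁅Z, (u : U)⁆ = 0) :
    B.formAlg Z H = 0 ∧
      ∀ α ∈ rootsAt 𝔥₀ U μ, ∀ Y ∈ realWtSpace 𝔥₀ 𝔤₀ α, B.formAlg Z Y = 0 := by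
  have := hmax.prop
  obtain ⟨v, hv, huv⟩ := B.onModule.exists_of_mem_realWtSpace hμ.1 u.2
  have hJv := B.onModule.conjugation_mem_wtSpace hv
  have hker : ∀ α ∈ rootsAt 𝔥₀ U μ, v ∉ rootKer 𝔥₀ U μ α := fun α hα h =>
    hu ⟨v, Or.inr (Set.mem_biUnion hα h), huv⟩
  -- The zero vector lies in every kernel, so this needs Φ_μ to be nonempty; negative definiteness
  -- of the Killing form enters here.
  have hv0 : v ≠ 0 := by
    obtain ⟨α, hα⟩ := rootsAt_nonempty hcompact B hmax hμ
    rintro rfl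
    exact hker α hα ⟨zero_mem _, fun X _ => complexified_lie_zero X⟩
  obtain ⟨f, hf, hfZ⟩ := B.onAlgebra.exists_weight_decomposition (𝔥₀ := 𝔥₀) (incl 𝔤₀ Z)
  have hzero : ∀ β, β ≠ 0 → β ∉ roots 𝔥₀ → f β = 0 := by
    intro β hβ hβr
    by_contra hne
    exact hβr ⟨hβ, fun h0 => hne (by have := hf β; rwa [h0, Submodule.mem_bot] at this)⟩
  have hμ2 : (2 : ℂ) • μ ≠ 0 := smul_ne_zero two_ne_zero hμ.1
  -- In Z u, only f β v and f (2μ + β) (J v) have weight μ + β. When the second is zero, pairing Z u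
  -- = 0 with the conjugate of f β v yields |f β v|² = 0.
  have hcomp : ∀ β, f ((2 : ℂ) • μ + β) = 0 → ⁅f β, v⁆ = 0 := by
    intro β hβ
    apply B.onModule.eq_zero_of_hermitian_eq_zero
    have hy := B.onModule.conjugation_mem_wtSpace (lie_mem_wtSpace (hf β) hv)
    have hy' : conjugation U ⁅f β, v⁆ ∈ wtSpace 𝔥₀ U (-(((2 : ℂ) • μ + β) + -μ)) := by
      rwa [show ((2 : ℂ) • μ + β) + -μ = β + μ by rw [two_smul]; abel]
    have h1 := B.onModule.complexForm_sum_lie f hf hv hy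
    have h2 := B.onModule.complexForm_sum_lie f hf hJv hy'
    rw [hβ, complexified_zero_lie, map_zero, LinearMap.zero_apply] at h2
    have h3 : B.onModule.complexForm ⁅incl 𝔤₀ Z, v + conjugation U v⁆
        (conjugation U ⁅f β, v⁆) = 0 := by
      rw [← huv, ← incl_lie, hZ]; simp
    rw [hfZ, complexified_lie_add, map_add, LinearMap.add_apply, h2, add_zero] at h3
    exact h1.symm.trans h3
  constructor
  · obtain ⟨h, hh⟩ := B.onAlgebra.exists_coe_eq_of_mem_wtSpace_zero hmax (hf 0)
    have h0 := hcomp 0 (by rw [add_zero]; exact hzero _ hμ2 hroot)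
    rw [← hh, lie_of_mem_wtSpace hv] at h0
    have h1 := B.onAlgebra.complexForm_incl Z H
    have h2 : incl 𝔤₀ H ∈ wtSpace 𝔥₀ 𝔤₀ (-0) := by
      rw [neg_zero]; exact coe_mem_wtSpace_zero (toComplexify 𝔥₀ ⟨H, hH.1⟩)
    rw [hfZ, B.onAlgebra.complexForm_sum f hf h2, ← hh, B.complexForm_realWeightVector hH,
      (smul_eq_zero.mp h0).resolve_right hv0, mul_zero] at h1
    exact_mod_cast h1.symm
  · intro α hα Y hY
    refine B.onAlgebra.form_eq_zero_of_mem_realWtSpace hα.1.1 (fun x hx => ?_) hY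
    have hx' : x ∈ wtSpace 𝔥₀ 𝔤₀ (-(-α)) := by rwa [neg_neg]
    rw [hfZ, B.onAlgebra.complexForm_sum f hf hx']
    suffices f (-α) = 0 by rw [this]; simp
    by_contra hne
    -- The functional 2μ - α is not zero, since 2μ is not a root, and it is not a root, since 2μ is
    -- not a sum of two roots.
    have h2 : f ((2 : ℂ) • μ + -α) = 0 := by
      apply hzero
      · intro h; apply hroot; rw [add_neg_eq_zero.mp h]; exact hα.1
      · intro h; exact hsum _ h α hα.1 (neg_add_cancel_right _ _).symm
    apply hker α hα
    refine ⟨hv, fun X hX => ?_⟩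
    -- A nonzero f (-α) spans its root line, so killing v with it puts v in the excluded kernel.
    obtain ⟨c, rfl⟩ := B.onAlgebra.exists_smul_eq_of_mem_rootSpace hmax
      (neg_ne_zero.mpr hα.1.1) (hf (-α)) hne hX
    rw [complexified_smul_lie, hcomp _ h2, smul_zero]

theorem formAlg_eq_zero_of_mem_realWtSpace [IsLieAbelian 𝔥₀] (B : InvariantInnerProduct 𝔤₀ U)
    {α : Module.Dual ℂ (complexify 𝔥₀)} (hα : α ≠ 0) {H Y : 𝔤₀} (hH : H ∈ 𝔥₀)
    (hY : Y ∈ realWtSpace 𝔥₀ 𝔤₀ α) : B.formAlg H Y = 0 := by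
  refine B.onAlgebra.form_eq_zero_of_mem_realWtSpace hα (fun x hx => ?_) hY
  exact B.onAlgebra.complexForm_eq_zero (by rwa [zero_add])
    (coe_mem_wtSpace_zero (toComplexify 𝔥₀ ⟨H, hH⟩)) hx

theorem disjoint_of_orthogonal (B : InvariantInnerProduct 𝔤₀ U) {S T : Submodule ℝ 𝔤₀}
    (h : ∀ X ∈ S, ∀ Y ∈ T, B.formAlg X Y = 0) : Disjoint S T := by
  rw [Submodule.disjoint_def]
  intro X hS hT
  by_contra hne
  exact (B.onAlgebra.pos X hne).ne' (h X hS X hT)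

/-- Orthogonality to the sum of the weight line and the real root spaces at `μ`. -/
theorem mem_orthogonal_sup_iff (B : InvariantInnerProduct 𝔤₀ U)
    {S : Set (Module.Dual ℂ (complexify 𝔥₀))} {H Z : 𝔤₀} :
    Z ∈ B.formAlg.orthogonal (Submodule.span ℝ {H} ⊔ ⨆ α ∈ S, realWtSpace 𝔥₀ 𝔤₀ α) ↔
      B.formAlg Z H = 0 ∧ ∀ α ∈ S, ∀ Y ∈ realWtSpace 𝔥₀ 𝔤₀ α, B.formAlg Z Y = 0 := by
  have hsymm : ∀ X Y, B.formAlg X Y = B.formAlg Y X := B.onAlgebra.symm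
  have hle : ∀ T : Submodule ℝ 𝔤₀, Z ∈ B.formAlg.orthogonal T ↔
      T ≤ LinearMap.ker (B.formAlg Z) := fun T => by
    refine ⟨fun h Y hY => ?_, fun h Y hY => ?_⟩
    · exact (hsymm Z Y).trans (h Y hY)
    · exact (hsymm Y Z).trans (h hY)
  rw [hle, sup_le_iff, Submodule.span_singleton_le_iff_mem, iSup₂_le_iff]
  rfl

end InvariantInnerProduct

end TwoStepNilpotent

theorem proposition6p12
    {𝔤₀ U : Type*} [LieRing 𝔤₀] [LieAlgebra ℝ 𝔤₀] [FiniteDimensional ℝ 𝔤₀]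
    [AddCommGroup U] [Module ℝ U] [FiniteDimensional ℝ U] [LieRingModule 𝔤₀ U] [LieModule ℝ 𝔤₀ U]
    -- `𝔤₀` is compact semisimple: its Killing form is negative definite
    (hcompact : ∀ X : 𝔤₀, X ≠ 0 → killingForm ℝ 𝔤₀ X X < 0)
    -- the inner product that defines `𝔫₀ = U ⊕ 𝔤₀`
    (B : InvariantInnerProduct 𝔤₀ U)
    -- `𝔥₀` is a maximal abelian subalgebra of `𝔤₀`
    (𝔥₀ : LieSubalgebra ℝ 𝔤₀) (hmax : Maximal (fun K : LieSubalgebra ℝ 𝔤₀ => IsLieAbelian K) 𝔥₀)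
    -- the weights are the disjoint union of `Λplus` and `-Λplus`
    (Λplus : Set (Module.Dual ℂ (complexify 𝔥₀)))
    (hunion : Λplus ∪ -Λplus = weights 𝔥₀ U) (hdisj : Disjoint Λplus (-Λplus))
    (μ : Module.Dual ℂ (complexify 𝔥₀)) (hμ : μ ∈ Λplus)
    (hroot : (2 : ℂ) • μ ∉ roots 𝔥₀)
    (hsum : ∀ α ∈ roots 𝔥₀, ∀ β ∈ roots 𝔥₀, (2 : ℂ) • μ ≠ α + β) :
    -- the exceptional set is a proper Zariski closed subset of `U_μ`
    (IsZariskiClosed (realExceptional 𝔥₀ U μ) ∧ realExceptional 𝔥₀ U μ ≠ Set.univ) ∧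
    -- the real weight vector exists and is unique
    (∃! H : 𝔤₀, B.IsRealWeightVector 𝔥₀ μ H) ∧
    ∀ H : 𝔤₀, B.IsRealWeightVector 𝔥₀ μ H →
      -- the three summands are independent
      iSupIndep ![Submodule.span ℝ {H}, realWtSpace 𝔥₀ 𝔤₀ μ,
        ⨆ α ∈ rootsAt 𝔥₀ U μ, realWtSpace 𝔥₀ 𝔤₀ α] ∧
      ∀ u : realWtSpace 𝔥₀ U μ,
        (LinearMap.range B.inU).map (LieAlgebra.ad ℝ B.Nil (B.inU u)) ≤
          (Submodule.span ℝ {H} ⊔ realWtSpace 𝔥₀ 𝔤₀ μ ⊔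
            ⨆ α ∈ rootsAt 𝔥₀ U μ, realWtSpace 𝔥₀ 𝔤₀ α).map B.inG ∧
        (u ∉ realExceptional 𝔥₀ U μ →
          (LinearMap.range B.inU).map (LieAlgebra.ad ℝ B.Nil (B.inU u)) =
            (Submodule.span ℝ {H} ⊔ realWtSpace 𝔥₀ 𝔤₀ μ ⊔
              ⨆ α ∈ rootsAt 𝔥₀ U μ, realWtSpace 𝔥₀ 𝔤₀ α).map B.inG) := by
  have habel := hmax.prop
  have hw : μ ∈ weights 𝔥₀ U := hunion ▸ Or.inl hμ
  -- Otherwise 2μ = μ + μ would be a sum of two roots.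
  have hnot : μ ∉ roots 𝔥₀ := fun h => hsum μ h μ h (two_smul ℂ μ)
  have hbot : realWtSpace 𝔥₀ 𝔤₀ μ = ⊥ := by
    refine B.onAlgebra.realWtSpace_eq_bot ?_
    by_contra h
    exact hnot ⟨hw.1, h⟩
  refine ⟨⟨isZariskiClosed_realExceptional hnot,
    B.onAlgebra.realExceptional_ne_univ B.onModule hmax hw hnot⟩,
    B.existsUnique_realWeightVector hw.2, fun H hH => ⟨?_, fun u => ?_⟩⟩
  · rw [hbot]
    -- With the middle summand zero, independence reduces to this: `𝔥₀` has weight zero and is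
    -- therefore orthogonal to all real root spaces.
    have hdis : Disjoint (Submodule.span ℝ {H}) (⨆ α ∈ rootsAt 𝔥₀ U μ, realWtSpace 𝔥₀ 𝔤₀ α) := by
      rw [disjoint_comm]
      refine B.disjoint_of_orthogonal fun X hX Y hY => ?_
      obtain ⟨r, rfl⟩ := Submodule.mem_span_singleton.mp hY
      rw [map_smul]
      suffices (⨆ α ∈ rootsAt 𝔥₀ U μ, realWtSpace 𝔥₀ 𝔤₀ α) ≤ LinearMap.ker (B.formAlg H) by
        rw [show B.formAlg X H = B.formAlg H X from B.onAlgebra.symm X H,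
          LinearMap.mem_ker.mp (this hX), smul_zero]
      exact iSup₂_le fun α hα Y hY => B.formAlg_eq_zero_of_mem_realWtSpace hα.1.1 hH.1 hY
    intro i
    have key : ∀ (S T : Submodule ℝ 𝔤₀), Disjoint S T → ∀ i : Fin 3,
        Disjoint (![S, ⊥, T] i) (⨆ j, ⨆ (_ : j ≠ i), ![S, ⊥, T] j) := by
      intro S T hST i
      fin_cases i <;> simp [iSup_fin_three, hST, hST.symm]
    exact key _ _ hdis i
  · rw [hbot, sup_bot_eq, B.map_ad_range]
    have hrefl : B.formAlg.IsRefl := fun X Y h => (B.onAlgebra.symm Y X).trans h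
    have horth := LinearMap.BilinForm.orthogonal_orthogonal B.formAlg_nondegenerate hrefl
    have hle : LinearMap.range (B.bracketU (u : U)) ≤
        Submodule.span ℝ {H} ⊔ ⨆ α ∈ rootsAt 𝔥₀ U μ, realWtSpace 𝔥₀ 𝔤₀ α := by
      -- Passing to orthogonal complements reverses the inclusion and turns it into a statement
      -- about annihilators of u.
      rw [← horth (LinearMap.range _), ← horth (_ ⊔ _)]
      refine LinearMap.BilinForm.orthogonal_le fun Z hZ => ?_
      rw [InvariantInnerProduct.mem_orthogonal_sup_iff] at hZ
      rw [B.mem_orthogonal_range_bracketU]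
      exact B.lie_eq_zero_of_orthogonal hmax hw.1 hH u.2 hZ.1 hZ.2
    refine ⟨Submodule.map_mono hle, fun hu => congrArg _ (le_antisymm hle ?_)⟩
    rw [← horth (LinearMap.range _), ← horth (_ ⊔ _)]
    refine LinearMap.BilinForm.orthogonal_le fun Z hZ => ?_
    rw [B.mem_orthogonal_range_bracketU] at hZ
    rw [InvariantInnerProduct.mem_orthogonal_sup_iff]
    exact B.orthogonal_of_lie_eq_zero hcompact hmax hw hroot hsum hH hu hZ
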